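/- Let $\mathcal X=[a,b]$ with $a<b$, let $k,n\ge 1$ be integers and let $x_1,\dots,x_n\in\mathcal X$ be equispaced: $x_{i+1}-x_i=(b-a)/n$ for $1\le i<n$. Let $Y_1,\dots,Y_n$ be independent integrable real random variables with $\mathbb E[Y_i]=f^\star(x_i)$, and for $q\in[1,2]$ let $\sigma_q\in(0,+\infty]$ satisfy $\big(\frac1n\sum_{i=1}^n\mathbb E|Y_i-\mathbb E Y_i|^q\big)^{1/q}\le\sigma_q$. *Function class.* $\mathcal C_k$ is the set of continuous $f:\mathcal X\to\mathbb R$ for which there is a partition $\mathcal J$ of $\mathcal X$ into at most $k$ intervals of positive length such that, on the closure of each $J\in\mathcal J$, $f$ is monotone and is either convex or concave. For such $f$ and $\mathcal J$, put $V_J=\sup_Jf-\inf_Jf$, $V=\sum_{J\in\mathcal J}V_J$, $n_J=|\{i:x_i\in J\}|$, and $$W=\Big[\sum_{J\in\mathcal J}\Big(\frac{n_JV_J\Gamma_J}{n}\Big)^{1/3}\Big]^3,\qquad \Gamma_J=1-\frac12\Big[\frac{|f'_r(u)|\wedge|f'_l(v)|}{|\Delta|}+\frac{|\Delta|}{|f'_r(u)|\vee|f'_l(v)|}\Big],\quad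 \Delta=\frac{f(v)-f(u)}{v-u},$$ where $[u,v]$ is the closure of $J$, $f'_r,f'_l\in[-\infty,+\infty]$ are the one-sided derivatives, and $0/0=1$, $1/(+\infty)=0$. *Risk bound.* Let $\ell(f,g)=\frac1n\sum_{i=1}^n|f(x_i)-g(x_i)|$ and $\ell(f,\mathcal G)=\inf_{g\in\mathcal G}\ell(f,g)$ (with $\inf\varnothing=+\infty$). For $D\ge1$ let $\mathcal O(D)$ be the set of those $\bar f\in\mathcal C_k$ for which both of the classes $\{\{x\in\mathcal X_n:f(x)>\bar f(x)\}:f\in\mathcal C_k\}$ and $\{\{x\in\mathcal X_n:f(x)<\bar f(x)\}:f\in\mathcal C_k\}$ of subsets of $\mathcal X_n=\{x_1,\dots,x_n\}$ have VC-dimension at most $D$. For a fixed numerical constant $\kappa>0$, put $$B_n(f^\star,\mathcal C_k)=\inf_{D\ge1}\Big\{3\,\ell(f^\star,\mathcal O(D))+\kappa\inf_{q\in[1,2]}\Big[\sigma_q\Big(\frac Dn\Big)^{1-1/q}\Big]\Big\}.$$ **Statement.** For every $\kappa>0$ there is a constant $C>0$, depending on $\kappa$ only, such that for all data as above with $f^\star\in\mathcal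 C_k$, for every partition $\mathcal J$ associated with $f^\star$ as in the definition of $\mathcal C_k$ (with the corresponding $V$ and $W$), and for every $p\in[1,2]$ with $\sigma_p<+\infty$, $$B_n(f^\star,\mathcal C_k)\le C\Big[\sigma_p^{\frac2{s+2}}\Big(\frac{\sqrt W}{n}\Big)^{\frac{2s}{s+2}}+\sigma_p\Big(\frac{7k-2}{n}\Big)^s+\frac Vn\Big],\qquad s=1-\frac1p.$$ -/

import Mathlib

open Set Filter Topology MeasureTheory ProbabilityTheory
open scoped ENNReal

noncomputable section

namespace ShapeRegression

/-! ### Vapnik-Chervonenkis dimension and extremal elements -/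

/-- The VC-dimension of the class `A` of subsets of `α` is not larger than `D`: every finite set `B`
with more than `D` elements has a subset that is not of the form `B ∩ S` with `S ∈ A`. -/
def VCDimLE {α : Type*} (A : Set (Set α)) (D : ℕ) : Prop :=
  ∀ B : Finset α, D < B.card → ∃ T : Set α, T ⊆ (B : Set α) ∧ ∀ S ∈ A, (B : Set α) ∩ S ≠ T

/-- The class of the sets `{g > gbar}`, `g ∈ G`. -/
def superlevelSets {α : Type*} (G : Set (α → ℝ)) (gbar : α → ℝ) : Set (Set α) :=
  {S | ∃ g ∈ G, S = {y | gbar y < g y}}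

/-- The class of the sets `{g < gbar}`, `g ∈ G`. -/
def sublevelSets {α : Type*} (G : Set (α → ℝ)) (gbar : α → ℝ) : Set (Set α) :=
  {S | ∃ g ∈ G, S = {y | g y < gbar y}}

/-- `gbar` is extremal in `G` with degree not larger than `D`. -/
def IsExtremal {α : Type*} (G : Set (α → ℝ)) (gbar : α → ℝ) (D : ℕ) : Prop :=
  gbar ∈ G ∧ 1 ≤ D ∧ VCDimLE (superlevelSets G gbar) D ∧ VCDimLE (sublevelSets G gbar) D

/-- The restrictions of the elements of `F` to the set of the design points `x 0, …, x (n - 1)`. -/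
def restrictClass {α : Type*} {n : ℕ} (x : Fin n → α) (F : Set (α → ℝ)) :
    Set (Set.range x → ℝ) :=
  (fun f => (Set.range x).domRestrict f) '' F

/-- The set `O(D)` of those elements of `F` whose restriction to the design is extremal, with degree
not larger than `D`, in the class of restrictions of elements of `F`. -/
def extremalSet {α : Type*} {n : ℕ} (x : Fin n → α) (F : Set (α → ℝ)) (D : ℕ) :
    Set (α → ℝ) :=
  {f | f ∈ F ∧ IsExtremal (restrictClass x F) ((Set.range x).domRestrict f) D}

/-! ### Loss, moments and risk bound -/

/-- The absolute loss `(1 / n) ∑ |f (x i) - g (x i)|`. -/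
def loss {α : Type*} {n : ℕ} (x : Fin n → α) (f g : α → ℝ) : ℝ :=
  (1 / (n : ℝ)) * ∑ i, |f (x i) - g (x i)|

/-- The approximation error `inf_{g ∈ G} loss f g`, equal to `+∞` if `G` is empty. -/
def lossToSet {α : Type*} {n : ℕ} (x : Fin n → α) (f : α → ℝ) (G : Set (α → ℝ)) : ℝ≥0∞ :=
  ⨅ g ∈ G, ENNReal.ofReal (loss x f g)

/-- The `p`-th root of the average over `i` of the `p`-th absolute central moments of `Y i`, with
value in `[0, +∞]`. -/
def averageMoment {Ω : Type*} [MeasurableSpace Ω] (μ : Measure Ω) {n : ℕ} (Y : Fin n → Ω → ℝ)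
    (p : ℝ) : ℝ≥0∞ :=
  ((∑ i, ∫⁻ ω, ENNReal.ofReal (|Y i ω - ∫ ω', Y i ω' ∂μ| ^ p) ∂μ) / (n : ℝ≥0∞)) ^ (1 / p)

/-- The risk bound
`inf_{D ≥ 1} { 3 loss(f, O(D)) + κ inf_{p ∈ [1, 2]} σ_p (D / n) ^ (1 - 1 / p) }`. -/
def riskBound {α : Type*} {n : ℕ} (κ : ℝ) (σ : ℝ → ℝ≥0∞) (x : Fin n → α) (f : α → ℝ)
    (F : Set (α → ℝ)) : ℝ≥0∞ :=
  ⨅ D : ℕ, ⨅ _ : 1 ≤ D,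
    3 * lossToSet x f (extremalSet x F D) +
      ENNReal.ofReal κ *
        ⨅ p ∈ Icc (1 : ℝ) 2, σ p * ENNReal.ofReal (((D : ℝ) / (n : ℝ)) ^ (1 - 1 / p))

/-! ### Piecewise monotone-convex-concave functions -/

/-- `P` is a partition of `[a, b]` into at most `k` nontrivial intervals such that `f` is monotone,
and convex or concave, on the closure of each of them. Functions on `[a, b]` are represented by
functions on the line, of which only the values on `[a, b]` are used. -/
def IsMCCPartition (a b : ℝ) (k : ℕ) (f : ℝ → ℝ) (P : Finset (Set ℝ)) : Prop :=
  P.card ≤ k ∧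
  (∀ J ∈ P, J.OrdConnected ∧ J.Nontrivial) ∧
  (P : Set (Set ℝ)).PairwiseDisjoint id ∧
  ⋃₀ (P : Set (Set ℝ)) = Icc a b ∧
  ∀ J ∈ P, (MonotoneOn f (closure J) ∨ AntitoneOn f (closure J)) ∧
    (ConvexOn ℝ (closure J) f ∨ ConcaveOn ℝ (closure J) f)

/-- The class of the `k`-piecewise monotone-convex-concave functions on `[a, b]`. -/
def mccClass (a b : ℝ) (k : ℕ) : Set (ℝ → ℝ) :=
  {f | ContinuousOn f (Icc a b) ∧ ∃ P : Finset (Set ℝ), IsMCCPartition a b k f P}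

/-- The right derivative in `[-∞, +∞]`. It is written as an upper limit of difference quotients,
which is a limit for every function that is convex or concave to the right of the point. -/
def rightDerivE (f : ℝ → ℝ) (u : ℝ) : EReal :=
  limsup (fun t => ((slope f u t : ℝ) : EReal)) (𝓝[>] u)

/-- The left derivative in `[-∞, +∞]`. -/
def leftDerivE (f : ℝ → ℝ) (v : ℝ) : EReal :=
  limsup (fun t => ((slope f v t : ℝ) : EReal)) (𝓝[<] v)

/-- The quotient in `[0, +∞]` with the conventions `0 / 0 = 1` and `y / (+∞) = 0` for finite `y`. -/
def indexRatio (y z : ℝ≥0∞) : ℝ≥0∞ :=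
  open Classical in if y = 0 ∧ z = 0 then 1 else y / z

/-- The linear index of a continuous, monotone, convex or concave function on `[u, v]`. -/
def linearIndex (f : ℝ → ℝ) (u v : ℝ) : ℝ :=
  1 - (1 / 2) *
    (indexRatio (min (rightDerivE f u).abs (leftDerivE f v).abs)
        (ENNReal.ofReal |(f v - f u) / (v - u)|) +
      indexRatio (ENNReal.ofReal |(f v - f u) / (v - u)|)
        (max (rightDerivE f u).abs (leftDerivE f v).abs)).toReal

/-- The variation `sup_J f - inf_J f` of `f` on `J`. -/
def variationOn (f : ℝ → ℝ) (J : Set ℝ) : ℝ :=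
  sSup (f '' J) - sInf (f '' J)

/-- The total variation of `f`, as a sum over the intervals of the partition `P`. -/
def totalVariation (f : ℝ → ℝ) (P : Finset (Set ℝ)) : ℝ :=
  ∑ J ∈ P, variationOn f J

/-- The number of indices `i` such that the design point `x i` falls in `J`. -/
def designCount {n : ℕ} (x : Fin n → ℝ) (J : Set ℝ) : ℕ :=
  Set.ncard {i : Fin n | x i ∈ J}

/-- The variation-index of `f` with respect to the partition `P`. The closure of an interval
`J` of `P` is `[sInf J, sSup J]`. -/
def variationIndex {n : ℕ} (x : Fin n → ℝ) (f : ℝ → ℝ) (P : Finset (Set ℝ)) : ℝ :=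
  (∑ J ∈ P, (((designCount x J : ℝ) * variationOn f J * linearIndex f (sInf J) (sSup J)) /
    (n : ℝ)) ^ (1 / 3 : ℝ)) ^ 3

/-- The points `x i` lie in `[a, b]` and two consecutive ones are at distance `(b - a) / n`. -/
def IsEquispaced (a b : ℝ) {n : ℕ} (x : Fin n → ℝ) : Prop :=
  (∀ i, x i ∈ Icc a b) ∧
    ∀ i j : Fin n, (i : ℕ) + 1 = (j : ℕ) → x j - x i = (b - a) / (n : ℝ)

end ShapeRegression

end

namespace ShapeRegression

/-! ### Piecewise linear interpolation of convex antitone functions -/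

/-! The bound trades the error of a piecewise affine approximant `F` of `f` against the VC-dimension
that its number of pieces costs.

On an interval `J` where `f` is monotone and convex or concave, interpolation on `m` cells whose
lengths grow linearly away from the steep end has total error at most `16 n_J V_J Γ_J / m ^ 2 + V_J`
over the design points in `J` (`exists_convex_antitone_interpolant`, `exists_interpolant`). Affine
functions are reproduced exactly, so only the excess of `|f v - f u|` over `α (v - u)` counts, with
`α` the smaller end slope; this excess is at most `2 V_J Γ_J` (`linearIndex_bounds`). The term `V_J`
is a rounding effect: a cell of length `ℓ` may hold `ℓ / h + 1` points.

The interpolants keep the shape and the end values of `f`, so they glue to an `F` in the class. If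
`F` is affine on `N` cells, then for any other member `g` the difference `g - F` is convex or
concave on each intersection of a piece of `g` with a cell, and its sign cannot alternate four times
there. Hence the degree of `F` is `O(k + N)` (`vcDimLE_of_ordConnected_pieces`,
`isExtremal_of_affine_pieces`).

Sharing about `m` cells in proportion to `(n_J V_J Γ_J) ^ (1 / 3)` gives error of order `W / m ^ 2 +
V / n` (`exists_allocation`), and `m` is chosen to balance `W / m ^ 2` against `σ_p (m / n) ^ s`
(`exists_dimension`). -/

theorem affine_nonneg_of_endpoints {A B p q t : ℝ} (hp : 0 ≤ A + B * p) (hq : 0 ≤ A + B * q)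
    (hpt : p ≤ t) (htq : t ≤ q) : 0 ≤ A + B * t := by
  rcases le_total 0 B with h | h <;> nlinarith

theorem convexOn_le_chord {G : ℝ → ℝ} {S : Set ℝ} (hG : ConvexOn ℝ S G) {p q t σ : ℝ}
    (hpS : p ∈ S) (hqS : q ∈ S) (hpq : p < q) (hσ : G p - G q = σ * (q - p))
    (hpt : p ≤ t) (htq : t ≤ q) : G t ≤ G p - σ * (t - p) := by
  rcases hpt.eq_or_lt with rfl | h1
  · simp
  rcases htq.eq_or_lt with rfl | h2
  · linarith
  have h := hG.slope_mono_adjacent hpS hqS h1 h2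
  rw [div_le_div_iff₀ (by linarith) (by linarith)] at h
  have : (G t - (G p - σ * (t - p))) * (q - p) ≤ 0 := by nlinarith
  nlinarith

theorem chord_le_convexOn {G : ℝ → ℝ} {S : Set ℝ} (hG : ConvexOn ℝ S G) {p q t σ : ℝ}
    (hpS : p ∈ S) (hqS : q ∈ S) (htS : t ∈ S) (hpq : p < q) (hσ : G p - G q = σ * (q - p))
    (ht : t ≤ p ∨ q ≤ t) : G p - σ * (t - p) ≤ G t := by
  have hpq' : 0 < q - p := by linarith
  rcases ht with ht | ht
  · rcases ht.eq_or_lt with rfl | h1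
    · simp
    have h := hG.slope_mono_adjacent htS hqS h1 hpq
    rw [div_le_div_iff₀ (by linarith) (by linarith)] at h
    have : (G p - G t) * (q - p) ≤ (-σ * (p - t)) * (q - p) := by nlinarith
    have := le_of_mul_le_mul_right this hpq'
    linarith
  · rcases ht.eq_or_lt with rfl | h1
    · linarith
    have h := hG.slope_mono_adjacent hpS htS hpq h1
    rw [div_le_div_iff₀ (by linarith) (by linarith)] at h
    have : (-σ * (t - q)) * (q - p) ≤ (G t - G q) * (q - p) := by nlinarith
    have := le_of_mul_le_mul_right this hpq'
    linarith

/-- The maximum of finitely many affine functions. -/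
def maxAffine (m : ℕ) (A B : ℕ → ℝ) (t : ℝ) : ℝ :=
  (Finset.range (m + 1)).sup' ⟨0, by simp⟩ fun i => A i - B i * t

theorem le_maxAffine {m : ℕ} (A B : ℕ → ℝ) (t : ℝ) {i : ℕ} (hi : i ≤ m) :
    A i - B i * t ≤ maxAffine m A B t :=
  Finset.le_sup' (fun i => A i - B i * t) (by simpa [Nat.lt_succ_iff] using hi)

theorem maxAffine_le {m : ℕ} {A B : ℕ → ℝ} {t c : ℝ} (h : ∀ i ≤ m, A i - B i * t ≤ c) :
    maxAffine m A B t ≤ c :=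
  Finset.sup'_le _ _ fun i hi => h i (by simpa [Nat.lt_succ_iff] using hi)

theorem convexOn_maxAffine (m : ℕ) (A B : ℕ → ℝ) : ConvexOn ℝ univ (maxAffine m A B) := by
  refine ⟨convex_univ, fun x _ y _ a b ha hb hab => maxAffine_le fun i hi => ?_⟩
  have h1 := mul_le_mul_of_nonneg_left (le_maxAffine A B x hi) ha
  have h2 := mul_le_mul_of_nonneg_left (le_maxAffine A B y hi) hb
  simp only [smul_eq_mul]
  have : A i = a * A i + b * A i := by rw [← add_mul, hab, one_mul]
  nlinarith

theorem antitone_maxAffine {m : ℕ} (A : ℕ → ℝ) {B : ℕ → ℝ} (hB : ∀ i ≤ m, 0 ≤ B i) :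
    Antitone (maxAffine m A B) := fun x y hxy => maxAffine_le fun i hi =>
  le_trans (by have := mul_le_mul_of_nonneg_left hxy (hB i hi); linarith) (le_maxAffine A B x hi)

theorem continuous_maxAffine (m : ℕ) (A B : ℕ → ℝ) : Continuous (maxAffine m A B) :=
  Continuous.finset_sup'_apply _ fun i _ => by fun_prop

/-- Abel summation, since `(2i+1)^2 - (2i-1)^2 = 8i ≤ 4(2i+1)`. The boundary term is there for the
induction and vanishes when `σ m = β`. -/
theorem sum_sq_mul_sub_le {σ : ℕ → ℝ} {β : ℝ} (m : ℕ) (hanti : ∀ i < m, σ (i + 1) ≤ σ i)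
    (hβ : ∀ i ≤ m, β ≤ σ i) :
    ∑ i ∈ Finset.range m, (2 * (i : ℝ) + 1) ^ 2 * (σ i - σ (i + 1)) + (2 * (m : ℝ)) ^ 2 * (σ m - β)
      ≤ 4 * ∑ i ∈ Finset.range m, (2 * (i : ℝ) + 1) * (σ i - β) := by
  induction m with
  | zero => simp
  | succ m ih =>
    have h := ih (fun i hi => hanti i (by omega)) (fun i hi => hβ i (by omega))
    rw [Finset.sum_range_succ, Finset.sum_range_succ]
    have h1 := hanti m (by omega)
    have h2 := hβ (m + 1) le_rfl
    push_cast
    have hm : (0 : ℝ) ≤ m := Nat.cast_nonneg m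
    nlinarith [mul_nonneg hm (sub_nonneg.2 h1)]

/-- The number of indices in `X` whose points fall in an interval of length `ℓ` is at most
`ℓ / h + 1`. -/
def Spread {n : ℕ} (h : ℝ) (X : Finset (Fin n)) (y : Fin n → ℝ) : Prop :=
  ∀ c d : ℝ, c ≤ d → (((X.filter fun j => c ≤ y j ∧ y j ≤ d).card : ℕ) : ℝ) ≤ (d - c) / h + 1

theorem exists_knot_interval {τ : ℕ → ℝ} {m : ℕ} {t : ℝ} (h0 : τ 0 ≤ t) (hm : t ≤ τ m)
    (hpos : 0 < m) : ∃ i < m, τ i ≤ t ∧ t ≤ τ (i + 1) := by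
  induction m with
  | zero => omega
  | succ m ih =>
    by_cases hc : τ m ≤ t
    · exact ⟨m, by omega, hc, hm⟩
    · rcases Nat.eq_zero_or_pos m with rfl | hp
      · exact absurd h0 hc
      · obtain ⟨i, hi, h⟩ := ih (not_le.1 hc).le hp
        exact ⟨i, by omega, h⟩

/-- `G` is steepest at `0`, so the knots are `L (i / m) ^ 2`. On a cell the error is at most the
drop to the next slope times the length. Multiplied by the point count `length / h + 1`, this splits
into a quadratic sum, controlled by `sum_sq_mul_sub_le`, and a linear sum that telescopes. -/
theorem exists_convex_antitone_interpolant {G : ℝ → ℝ} {L β : ℝ} (hL : 0 < L) (hβ0 : 0 ≤ β)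
    (hG : ConvexOn ℝ (Icc 0 L) G)
    (hβ : ∀ t t', 0 ≤ t → t ≤ t' → t' ≤ L → β * (t' - t) ≤ G t - G t') {m : ℕ} (hm : 0 < m) :
    ∃ (g : ℝ → ℝ) (τ : ℕ → ℝ), Continuous g ∧ ConvexOn ℝ univ g ∧ Antitone g ∧
      τ 0 = 0 ∧ τ m = L ∧
      (∀ i < m, ∃ A B : ℝ, ∀ t ∈ Icc (τ i) (τ (i + 1)), g t = A + B * t) ∧
      g 0 = G 0 ∧ g L = G L ∧
      ∀ (h : ℝ), 0 < h → ∀ (n : ℕ) (X : Finset (Fin n)) (y : Fin n → ℝ), Spread h X y →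
        (∀ j ∈ X, y j ∈ Icc 0 L) →
        ∑ j ∈ X, |G (y j) - g (y j)| ≤
          4 * L * (G 0 - G L - β * L) / ((m : ℝ) ^ 2 * h) + (G 0 - G L) := by
  have hm' : (0 : ℝ) < m := by exact_mod_cast hm
  set c : ℝ := L / (m : ℝ) ^ 2 with hc
  have hc0 : 0 < c := by positivity
  have hcL : c * (m : ℝ) ^ 2 = L := by rw [hc]; field_simp
  set τ : ℕ → ℝ := fun i => c * (i : ℝ) ^ 2 with hτ
  have hτm : τ m = L := hcL
  have hτ0 : τ 0 = 0 := by simp [hτ]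
  have hmono : StrictMono τ := by
    refine strictMono_nat_of_lt_succ fun i => ?_
    simp only [hτ]
    push_cast
    have : (0 : ℝ) ≤ i := Nat.cast_nonneg i
    nlinarith
  have hlen : ∀ i, τ (i + 1) - τ i = c * (2 * (i : ℝ) + 1) := fun i => by
    simp only [hτ]; push_cast; ring
  have hlen0 : ∀ i, 0 < τ (i + 1) - τ i := fun i => sub_pos.2 (hmono (Nat.lt_succ_self i))
  have hmem : ∀ i ≤ m, τ i ∈ Icc 0 L := fun i hi =>
    ⟨by rw [← hτ0]; exact hmono.monotone (Nat.zero_le i), by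
      rw [← hτm]; exact hmono.monotone hi⟩
  -- The value `β` at index `m` plays the part of a cell beyond `L`: the line of slope `-β` through
  -- `(L, G L)` lies below `G`, so the last cell is treated like the others.
  set σ : ℕ → ℝ := fun i => if i < m then (G (τ i) - G (τ (i + 1))) / (τ (i + 1) - τ i) else β
    with hσ
  have hσi : ∀ i < m, G (τ i) - G (τ (i + 1)) = σ i * (τ (i + 1) - τ i) := fun i hi => by
    simp only [hσ, if_pos hi]
    rw [div_mul_cancel₀ _ (hlen0 i).ne']
  have hσm : σ m = β := by simp [hσ]
  have hsub : ∀ i ≤ m, ∀ t ∈ Icc 0 L, (i < m → t ≤ τ i ∨ τ (i + 1) ≤ t) →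
      G (τ i) - σ i * (t - τ i) ≤ G t := by
    intro i hi t ht hcase
    rcases hi.eq_or_lt with rfl | hlt
    · rw [hσm, hτm]
      have := hβ t L ht.1 ht.2 le_rfl
      linarith
    · exact chord_le_convexOn hG (hmem i hi) (hmem (i + 1) hlt) ht (by linarith [hlen0 i])
        (hσi i hlt) (hcase hlt)
  have hσβ : ∀ i ≤ m, β ≤ σ i := by
    intro i hi
    rcases hi.eq_or_lt with rfl | hlt
    · exact hσm.ge
    · have h1 := hβ (τ i) (τ (i + 1)) (hmem i hi).1 (by linarith [hlen0 i]) (hmem (i + 1) hlt).2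
      rw [hσi i hlt] at h1
      exact le_of_mul_le_mul_right h1 (hlen0 i)
  have hanti : ∀ i < m, σ (i + 1) ≤ σ i := by
    intro i hi
    have h1 := hsub (i + 1) hi (τ i) (hmem i hi.le) (fun _ => Or.inl (by linarith [hlen0 i]))
    have h2 := hσi i hi
    refine le_of_mul_le_mul_right (?_ : _ ≤ σ i * (τ (i + 1) - τ i)) (hlen0 i)
    linarith
  set A : ℕ → ℝ := fun i => G (τ i) + σ i * τ i with hA
  have hAl : ∀ i t, A i - σ i * t = G (τ i) - σ i * (t - τ i) := fun i t => by
    simp only [hA]; ring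
  have hpiece : ∀ i < m, ∀ t ∈ Icc (τ i) (τ (i + 1)),
      maxAffine m A σ t = A i - σ i * t := by
    intro i hi t ht
    -- Every line is below `G` at the two knots of cell `i`, where line `i` equals `G`; a difference
    -- of affine functions keeps its sign between them.
    refine le_antisymm (maxAffine_le fun j hj => ?_) (le_maxAffine A σ t hi.le)
    have key : ∀ l ≤ m, A j - σ j * τ l ≤ G (τ l) := fun l hl => by
      rw [hAl]
      refine hsub j hj _ (hmem l hl) fun _ => ?_
      rcases Nat.lt_or_ge j l with h | h
      · exact Or.inr (hmono.monotone h)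
      · exact Or.inl (hmono.monotone h)
    have h1 := key i hi.le
    have h2 := key (i + 1) hi
    have h3 := hσi i hi
    have := affine_nonneg_of_endpoints (A := A i - A j) (B := σ j - σ i) (t := t)
      (by have := hAl i (τ i); simp only [sub_self, mul_zero, sub_zero] at this; linarith)
      (by have := hAl i (τ (i + 1)); linarith) ht.1 ht.2
    linarith
  have hval : ∀ i < m, maxAffine m A σ (τ i) = G (τ i) := fun i hi => by
    rw [hpiece i hi _ ⟨le_rfl, by linarith [hlen0 i]⟩, hAl]; ring
  have hvalL : maxAffine m A σ L = G L := by
    obtain ⟨l, rfl⟩ : ∃ l, m = l + 1 := ⟨m - 1, by omega⟩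
    rw [← hτm, hpiece l (by omega) _ ⟨by linarith [hlen0 l], le_rfl⟩, hAl]
    linarith [hσi l (by omega)]
  -- `G` lies below its chord on cell `i` and above the prolonged next chord; at `t` the two differ
  -- by `(σ i - σ (i + 1)) (τ (i + 1) - t)`.
  have herr : ∀ i < m, ∀ t ∈ Icc (τ i) (τ (i + 1)),
      |G t - maxAffine m A σ t| ≤ (σ i - σ (i + 1)) * (τ (i + 1) - τ i) := by
    intro i hi t ht
    have htL : t ∈ Icc 0 L := ⟨(hmem i hi.le).1.trans ht.1, ht.2.trans (hmem (i + 1) hi).2⟩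
    rw [hpiece i hi t ht, hAl, abs_le]
    have h1 := convexOn_le_chord hG (hmem i hi.le) (hmem (i + 1) hi) (by linarith [hlen0 i])
      (hσi i hi) ht.1 ht.2
    have h2 := hsub (i + 1) hi t htL (fun _ => Or.inl ht.2)
    have h3 := hσi i hi
    have h4 : (σ i - σ (i + 1)) * (τ (i + 1) - t) ≤ (σ i - σ (i + 1)) * (τ (i + 1) - τ i) :=
      mul_le_mul_of_nonneg_left (by linarith [ht.1]) (sub_nonneg.2 (hanti i hi))
    have h5 : 0 ≤ (σ i - σ (i + 1)) * (τ (i + 1) - τ i) :=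
      mul_nonneg (sub_nonneg.2 (hanti i hi)) (hlen0 i).le
    constructor <;> nlinarith
  have htel : ∑ i ∈ Finset.range m, σ i * (τ (i + 1) - τ i) = G 0 - G L := by
    rw [← hτ0, ← hτm, ← Finset.sum_range_sub' (fun i => G (τ i)) m]
    exact Finset.sum_congr rfl fun i hi => (hσi i (Finset.mem_range.1 hi)).symm
  have htelL : ∑ i ∈ Finset.range m, (τ (i + 1) - τ i) = L := by
    rw [Finset.sum_range_sub, hτm, hτ0, sub_zero]
  have hlin : ∑ i ∈ Finset.range m, (σ i - σ (i + 1)) * (τ (i + 1) - τ i) ≤ G 0 - G L := by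
    rw [← htel]
    refine Finset.sum_le_sum fun i hi => mul_le_mul_of_nonneg_right ?_ (hlen0 i).le
    have := hσβ (i + 1) (Finset.mem_range.1 hi)
    linarith
  have hquad : ∑ i ∈ Finset.range m, (σ i - σ (i + 1)) * (τ (i + 1) - τ i) ^ 2 ≤
      4 * c * (G 0 - G L - β * L) := by
    have h1 := sum_sq_mul_sub_le m hanti hσβ
    rw [hσm, sub_self, mul_zero, add_zero] at h1
    have h2 : ∑ i ∈ Finset.range m, (2 * (i : ℝ) + 1) * (σ i - β) * c = G 0 - G L - β * L := by
      rw [← htel, ← htelL, Finset.mul_sum, ← Finset.sum_sub_distrib]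
      exact Finset.sum_congr rfl fun i _ => by rw [hlen]; ring
    have h3 : ∑ i ∈ Finset.range m, (σ i - σ (i + 1)) * (τ (i + 1) - τ i) ^ 2 =
        c ^ 2 * ∑ i ∈ Finset.range m, (2 * (i : ℝ) + 1) ^ 2 * (σ i - σ (i + 1)) := by
      rw [Finset.mul_sum]
      exact Finset.sum_congr rfl fun i _ => by rw [hlen]; ring
    rw [h3, ← h2, ← Finset.sum_mul]
    calc _ ≤ c ^ 2 * _ := mul_le_mul_of_nonneg_left h1 (by positivity)
      _ = _ := by ring
  refine ⟨maxAffine m A σ, τ, continuous_maxAffine m A σ, convexOn_maxAffine m A σ,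
    antitone_maxAffine A fun i hi => hβ0.trans (hσβ i hi), hτ0, hτm,
    fun i hi => ⟨A i, -σ i, fun t ht => by rw [hpiece i hi t ht]; ring⟩,
    by rw [← hτ0]; exact hval 0 hm, hvalL, ?_⟩
  intro h hh n X y hspread hy
  -- The closed cells share their knots, so a point may be counted twice; an inequality is enough.
  have step1 : ∑ j ∈ X, |G (y j) - maxAffine m A σ (y j)| ≤
      ∑ i ∈ Finset.range m, ∑ j ∈ X.filter (fun j => τ i ≤ y j ∧ y j ≤ τ (i + 1)),
        |G (y j) - maxAffine m A σ (y j)| := by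
    simp only [Finset.sum_filter]
    rw [Finset.sum_comm]
    refine Finset.sum_le_sum fun j hj => ?_
    obtain ⟨i, hi, hji⟩ := exists_knot_interval (τ := τ) (m := m) (t := y j)
      (by rw [hτ0]; exact (hy j hj).1) (by rw [hτm]; exact (hy j hj).2) hm
    refine le_trans (by rw [if_pos hji]) (Finset.single_le_sum (f := fun i =>
      if τ i ≤ y j ∧ y j ≤ τ (i + 1) then |G (y j) - maxAffine m A σ (y j)| else 0)
      (fun i _ => ?_) (Finset.mem_range.2 hi))
    split_ifs
    · exact abs_nonneg _
    · exact le_rfl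
  have step2 : ∀ i ∈ Finset.range m,
      ∑ j ∈ X.filter (fun j => τ i ≤ y j ∧ y j ≤ τ (i + 1)), |G (y j) - maxAffine m A σ (y j)| ≤
        (σ i - σ (i + 1)) * (τ (i + 1) - τ i) ^ 2 / h +
          (σ i - σ (i + 1)) * (τ (i + 1) - τ i) := by
    intro i hi
    have hi := Finset.mem_range.1 hi
    have h5 : 0 ≤ (σ i - σ (i + 1)) * (τ (i + 1) - τ i) :=
      mul_nonneg (sub_nonneg.2 (hanti i hi)) (hlen0 i).le
    calc _ ≤ (X.filter (fun j => τ i ≤ y j ∧ y j ≤ τ (i + 1))).card •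
          ((σ i - σ (i + 1)) * (τ (i + 1) - τ i)) :=
          Finset.sum_le_card_nsmul _ _ _ fun j hj => herr i hi _ (Finset.mem_filter.1 hj).2
      _ ≤ ((τ (i + 1) - τ i) / h + 1) * ((σ i - σ (i + 1)) * (τ (i + 1) - τ i)) := by
          rw [nsmul_eq_mul]
          exact mul_le_mul_of_nonneg_right (hspread _ _ (by linarith [hlen0 i])) h5
      _ = _ := by ring
  refine step1.trans ((Finset.sum_le_sum step2).trans ?_)
  rw [Finset.sum_add_distrib, ← Finset.sum_div]
  refine add_le_add ?_ hlin
  calc _ ≤ 4 * c * (G 0 - G L - β * L) / h := div_le_div_of_nonneg_right hquad hh.le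
    _ = _ := by rw [hc]; field_simp

/-! ### Interpolation on a general interval, reduced by symmetry to the convex antitone case. -/

theorem convexOn_comp_affine {f : ℝ → ℝ} {S T : Set ℝ} (hf : ConvexOn ℝ S f) (hT : Convex ℝ T)
    (c δ : ℝ) (h : ∀ t ∈ T, c + δ * t ∈ S) : ConvexOn ℝ T fun t => f (c + δ * t) := by
  refine ⟨hT, fun x hx y hy a b ha hb hab => ?_⟩
  have := hf.2 (h x hx) (h y hy) ha hb hab
  have e : c + δ * (a • x + b • y) = a • (c + δ * x) + b • (c + δ * y) := by
    simp only [smul_eq_mul]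
    linear_combination (-c) * hab
  simpa only [e] using this

/-- `g` is a piecewise affine interpolant of `f` on `[u, v]` with `m` pieces, of the same shape as
`f`, with cumulated error at spread points controlled by `4 (v - u) E / (m ^ 2 h)` and the increment
of `f`. -/
def IsInterpolant (f : ℝ → ℝ) (u v E : ℝ) (m : ℕ) (g : ℝ → ℝ) (I : ℕ → Set ℝ) : Prop :=
  Continuous g ∧ (Monotone g ∨ Antitone g) ∧ (ConvexOn ℝ univ g ∨ ConcaveOn ℝ univ g) ∧
  (∀ i, (I i).OrdConnected) ∧ (∀ t ∈ Icc u v, ∃ i < m, t ∈ I i) ∧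
  (∀ i < m, ∃ A B : ℝ, ∀ t ∈ I i, g t = A + B * t) ∧ g u = f u ∧ g v = f v ∧
  ∀ (h : ℝ), 0 < h → ∀ (n : ℕ) (X : Finset (Fin n)) (y : Fin n → ℝ), Spread h X y →
    (∀ j ∈ X, y j ∈ Icc u v) →
    ∑ j ∈ X, |f (y j) - g (y j)| ≤ 4 * (v - u) * E / ((m : ℝ) ^ 2 * h) + |f v - f u|

theorem IsInterpolant.neg {f g : ℝ → ℝ} {u v E : ℝ} {m : ℕ} {I : ℕ → Set ℝ}
    (hg : IsInterpolant f u v E m g I) :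
    IsInterpolant (fun x => -f x) u v E m (fun x => -g x) I := by
  obtain ⟨h1, h2, h3, h4, h5, h6, h7, h8, h9⟩ := hg
  refine ⟨h1.neg, h2.symm.imp (fun h => h.neg) (fun h => h.neg),
    h3.symm.imp (fun h => h.neg) (fun h => h.neg), h4, h5, fun i hi => ?_, by simp [h7],
    by simp [h8], ?_⟩
  · obtain ⟨A, B, h⟩ := h6 i hi
    exact ⟨-A, -B, fun t ht => by simp only [h t ht]; ring⟩
  · intro h hh n X y hs hy
    have e1 : ∀ a b : ℝ, |-a - -b| = |a - b| := fun a b => by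
      rw [show -a - -b = -(a - b) by ring, abs_neg]
    simpa only [e1] using h9 h hh n X y hs hy

/-- Reflection in the midpoint exchanges monotone and antitone and keeps convexity. `Spread`
survives because it involves only lengths of intervals. -/
theorem IsInterpolant.reflect {f g : ℝ → ℝ} {u v E : ℝ} {m : ℕ} {I : ℕ → Set ℝ}
    (hg : IsInterpolant f u v E m g I) :
    IsInterpolant (fun x => f (u + v - x)) u v E m (fun x => g (u + v - x))
      (fun i => (fun x => u + v - x) ⁻¹' I i) := by
  obtain ⟨h1, h2, h3, h4, h5, h6, h7, h8, h9⟩ := hg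
  have hanti : Antitone fun x : ℝ => u + v - x := fun x y hxy => by dsimp only; linarith
  have e : (fun x => g (u + v - x)) = fun x => g (u + v + (-1) * x) := by
    funext x; congr 1; ring
  refine ⟨h1.comp (by fun_prop), h2.symm.imp (fun h => h.comp hanti) (fun h => h.comp_antitone hanti),
    ?_, fun i => (h4 i).preimage_anti hanti, fun t ht => h5 _ ?_, fun i hi => ?_, ?_, ?_, ?_⟩
  · refine h3.imp (fun h => ?_) (fun h => ?_)
    · rw [e]
      exact convexOn_comp_affine h convex_univ _ _ fun _ _ => mem_univ _
    · rw [e, ← neg_convexOn_iff]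
      exact convexOn_comp_affine h.neg convex_univ _ _ fun _ _ => mem_univ _
  · exact ⟨by linarith [ht.2], by linarith [ht.1]⟩
  · obtain ⟨A, B, h⟩ := h6 i hi
    exact ⟨A + B * (u + v), -B, fun t ht => (h _ ht).trans (by ring)⟩
  · simpa using h8
  · simpa using h7
  · intro h hh n X y hs hy
    have := h9 h hh n X (fun j => u + v - y j) (fun c d hcd => ?_) (fun j hj => ?_)
    · refine this.trans_eq ?_
      simp only [add_sub_cancel_left, add_sub_cancel_right]
      rw [abs_sub_comm (f v)]
    · have := hs (u + v - d) (u + v - c) (by linarith)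
      have e2 : (X.filter fun j => c ≤ u + v - y j ∧ u + v - y j ≤ d) =
          X.filter fun j => u + v - d ≤ y j ∧ y j ≤ u + v - c :=
        Finset.filter_congr fun j _ =>
          ⟨fun h => ⟨by linarith, by linarith⟩, fun h => ⟨by linarith, by linarith⟩⟩
      rw [e2]
      refine this.trans_eq ?_
      ring
    · have := hy j hj
      exact ⟨by linarith [this.2], by linarith [this.1]⟩

theorem exists_interpolant_of_convex_antitone {f : ℝ → ℝ} {u v α : ℝ} (huv : u < v)
    (hα0 : 0 ≤ α) (hf : AntitoneOn f (Icc u v)) (hc : ConvexOn ℝ (Icc u v) f)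
    (hα : ∀ x y, u ≤ x → x ≤ y → y ≤ v → α * (y - x) ≤ |f y - f x|) {m : ℕ} (hm : 0 < m) :
    ∃ g I, IsInterpolant f u v (|f v - f u| - α * (v - u)) m g I := by
  have habs : ∀ x y, u ≤ x → x ≤ y → y ≤ v → |f y - f x| = f x - f y := fun x y h1 h2 h3 => by
    rw [abs_sub_comm]
    exact abs_of_nonneg (sub_nonneg.2 (hf ⟨h1, h2.trans h3⟩ ⟨h1.trans h2, h3⟩ h2))
  have hL : 0 < v - u := by linarith
  obtain ⟨g, τ, h1, h2, h3, h4, h5, h6, h7, h8, h9⟩ :=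
    exists_convex_antitone_interpolant (G := fun t => f (u + 1 * t)) hL hα0
      (convexOn_comp_affine hc (convex_Icc _ _) u 1 fun t ht =>
        ⟨by linarith [ht.1], by linarith [ht.2]⟩)
      (fun t t' ht htt ht' => by
        have := hα (u + 1 * t) (u + 1 * t') (by linarith) (by linarith) (by linarith)
        rw [habs _ _ (by linarith) (by linarith) (by linarith)] at this
        linarith) hm
  simp only [one_mul, add_zero, add_sub_cancel] at h7 h8 h9
  have hmono : Monotone fun x : ℝ => x - u := fun x y hxy => by dsimp only; linarith
  refine ⟨fun x => g (x - u), fun i => (fun x => x - u) ⁻¹' Icc (τ i) (τ (i + 1)),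
    h1.comp (by fun_prop), Or.inr (h3.comp_monotone hmono), Or.inl ?_,
    fun i => ordConnected_Icc.preimage_mono hmono, fun t ht => ?_, fun i hi => ?_, by simpa using h7,
    h8, ?_⟩
  · have e : (fun x => g (x - u)) = fun x => g (-u + 1 * x) := by funext x; congr 1; ring
    rw [e]
    exact convexOn_comp_affine h2 convex_univ _ _ fun _ _ => mem_univ _
  · exact exists_knot_interval (by rw [h4]; linarith [ht.1]) (by rw [h5]; linarith [ht.2]) hm
  · obtain ⟨A, B, h⟩ := h6 i hi
    exact ⟨A - B * u, B, fun t ht => (h _ ht).trans (by ring)⟩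
  · intro h hh n X y hs hy
    have := h9 h hh n X (fun j => y j - u) (fun c d hcd => ?_) (fun j hj => ?_)
    · rw [habs u v le_rfl huv.le le_rfl]
      simpa only [add_sub_cancel] using this
    · have := hs (c + u) (d + u) (by linarith)
      have e2 : (X.filter fun j => c ≤ y j - u ∧ y j - u ≤ d) =
          X.filter fun j => c + u ≤ y j ∧ y j ≤ d + u :=
        Finset.filter_congr fun j _ =>
          ⟨fun h => ⟨by linarith, by linarith⟩, fun h => ⟨by linarith, by linarith⟩⟩
      rw [e2]
      refine this.trans_eq ?_
      ring
    · have := hy j hj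
      exact ⟨by linarith [this.1], by linarith [this.2]⟩

theorem exists_interpolant_of_convex {f : ℝ → ℝ} {u v α : ℝ} (huv : u < v) (hα0 : 0 ≤ α)
    (hf : MonotoneOn f (Icc u v) ∨ AntitoneOn f (Icc u v)) (hc : ConvexOn ℝ (Icc u v) f)
    (hα : ∀ x y, u ≤ x → x ≤ y → y ≤ v → α * (y - x) ≤ |f y - f x|) {m : ℕ} (hm : 0 < m) :
    ∃ g I, IsInterpolant f u v (|f v - f u| - α * (v - u)) m g I := by
  rcases hf with hf | hf
  · have hmem : ∀ t ∈ Icc u v, u + v - t ∈ Icc u v := fun t ht =>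
      ⟨by linarith [ht.2], by linarith [ht.1]⟩
    have hc' := convexOn_comp_affine hc (convex_Icc u v) (u + v) (-1) fun t ht => by
      convert hmem t ht using 1; ring
    have e : (fun t => f (u + v + (-1) * t)) = fun t => f (u + v - t) := by
      funext t; congr 1; ring
    rw [e] at hc'
    obtain ⟨g, I, h⟩ := exists_interpolant_of_convex_antitone (f := fun t => f (u + v - t)) huv hα0
      (fun x hx y hy hxy => hf (hmem y hy) (hmem x hx) (by linarith)) hc'
      (fun x y h1 h2 h3 => by
        have := hα (u + v - y) (u + v - x) (by linarith) (by linarith) (by linarith)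
        rw [abs_sub_comm]
        linarith) hm
    have := h.reflect
    simp only [sub_sub_cancel, add_sub_cancel_left, add_sub_cancel_right] at this
    rw [abs_sub_comm] at this
    exact ⟨_, _, this⟩
  · exact exists_interpolant_of_convex_antitone huv hα0 hf hc hα hm

theorem exists_interpolant {f : ℝ → ℝ} {u v α : ℝ} (huv : u < v) (hα0 : 0 ≤ α)
    (hf : MonotoneOn f (Icc u v) ∨ AntitoneOn f (Icc u v))
    (hc : ConvexOn ℝ (Icc u v) f ∨ ConcaveOn ℝ (Icc u v) f)
    (hα : ∀ x y, u ≤ x → x ≤ y → y ≤ v → α * (y - x) ≤ |f y - f x|) {m : ℕ} (hm : 0 < m) :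
    ∃ g I, IsInterpolant f u v (|f v - f u| - α * (v - u)) m g I := by
  rcases hc with hc | hc
  · exact exists_interpolant_of_convex huv hα0 hf hc hα hm
  · have e1 : ∀ a b : ℝ, |-a - -b| = |a - b| := fun a b => by
      rw [show -a - -b = -(a - b) by ring, abs_neg]
    obtain ⟨g, I, h⟩ := exists_interpolant_of_convex (f := fun x => -f x) huv hα0
      (hf.symm.imp (fun h => h.neg) (fun h => h.neg)) hc.neg
      (fun x y h1 h2 h3 => by rw [e1]; exact hα x y h1 h2 h3) hm
    have := h.neg
    simp only [neg_neg, e1] at this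
    exact ⟨_, _, this⟩

/-! ### The linear index -/

/-- Bounds on difference quotients pass directly to their upper limit, so one-sided derivatives need
not be shown to exist. -/
theorem abs_limsup_coe_le {l : Filter ℝ} [l.NeBot] {g : ℝ → ℝ} {M : ℝ}
    (h : ∀ᶠ t in l, |g t| ≤ M) :
    (limsup (fun t => ((g t : ℝ) : EReal)) l).abs ≤ ENNReal.ofReal M := by
  have h1 : limsup (fun t => ((g t : ℝ) : EReal)) l ≤ (M : EReal) :=
    limsup_le_of_le (by isBoundedDefault)
      (h.mono fun t ht => EReal.coe_le_coe_iff.2 (abs_le.1 ht).2)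
  have h2 : ((-M : ℝ) : EReal) ≤ limsup (fun t => ((g t : ℝ) : EReal)) l :=
    le_limsup_of_frequently_le
      (h.mono fun t ht => EReal.coe_le_coe_iff.2 (abs_le.1 ht).1).frequently (by isBoundedDefault)
  generalize limsup (fun t => ((g t : ℝ) : EReal)) l = x at h1 h2
  induction x with
  | bot => exact absurd h2 (by simp)
  | top => exact absurd h1 (by simp)
  | coe x =>
    rw [EReal.abs_def]
    exact ENNReal.ofReal_le_ofReal
      (abs_le.2 ⟨EReal.coe_le_coe_iff.1 h2, EReal.coe_le_coe_iff.1 h1⟩)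

theorem le_abs_limsup_coe {l : Filter ℝ} [l.NeBot] {g : ℝ → ℝ} {S : ℝ}
    (h : (∀ᶠ t in l, S ≤ g t) ∨ ∀ᶠ t in l, g t ≤ -S) :
    ENNReal.ofReal S ≤ (limsup (fun t => ((g t : ℝ) : EReal)) l).abs := by
  have h' : (S : EReal) ≤ limsup (fun t => ((g t : ℝ) : EReal)) l ∨
      limsup (fun t => ((g t : ℝ) : EReal)) l ≤ ((-S : ℝ) : EReal) := by
    refine h.imp (fun h => ?_) (fun h => ?_)
    · exact le_limsup_of_frequently_le
        (h.mono fun t ht => EReal.coe_le_coe_iff.2 ht).frequently (by isBoundedDefault)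
    · exact limsup_le_of_le (by isBoundedDefault)
        (h.mono fun t ht => EReal.coe_le_coe_iff.2 ht)
  generalize limsup (fun t => ((g t : ℝ) : EReal)) l = x at h'
  induction x with
  | bot => simp
  | top => simp
  | coe x =>
    rw [EReal.abs_def]
    refine ENNReal.ofReal_le_ofReal ?_
    rcases h' with h' | h'
    · exact (EReal.coe_le_coe_iff.1 h').trans (le_abs_self x)
    · have := EReal.coe_le_coe_iff.1 h'
      linarith [neg_le_abs x]

theorem indexRatio_le_one {y z : ℝ≥0∞} (h : y ≤ z) : indexRatio y z ≤ 1 := by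
  unfold indexRatio
  split_ifs
  · exact le_rfl
  · exact ENNReal.div_le_of_le_mul (by simpa using h)

/-- Both ratios in the index are at most `1`. Replacing the second by `1` leaves `2 Γ ≥ 1 - min /
|Δ|`, to be multiplied by `|f v - f u| = |Δ| (v - u)`. -/
theorem linearIndex_bounds {f : ℝ → ℝ} {u v : ℝ} (huv : u < v)
    (hmin : min (rightDerivE f u).abs (leftDerivE f v).abs ≤
      ENNReal.ofReal |(f v - f u) / (v - u)|)
    (hmax : ENNReal.ofReal |(f v - f u) / (v - u)| ≤
      max (rightDerivE f u).abs (leftDerivE f v).abs) :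
    0 ≤ linearIndex f u v ∧
      |f v - f u| - (min (rightDerivE f u).abs (leftDerivE f v).abs).toReal * (v - u) ≤
        2 * |f v - f u| * linearIndex f u v := by
  have hL : 0 < v - u := sub_pos.2 huv
  unfold linearIndex
  generalize min (rightDerivE f u).abs (leftDerivE f v).abs = mn at *
  generalize max (rightDerivE f u).abs (leftDerivE f v).abs = mx at *
  have hD : |f v - f u| = |(f v - f u) / (v - u)| * (v - u) := by
    rw [abs_div, abs_of_pos hL, div_mul_cancel₀ _ hL.ne']
  rw [hD]
  generalize hS : |(f v - f u) / (v - u)| = S at *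
  have hS0 : 0 ≤ S := hS ▸ abs_nonneg _
  have r1 := indexRatio_le_one hmin
  have r2 := indexRatio_le_one hmax
  have e : (indexRatio mn (ENNReal.ofReal S) + indexRatio (ENNReal.ofReal S) mx).toReal =
      (indexRatio mn (ENNReal.ofReal S)).toReal + (indexRatio (ENNReal.ofReal S) mx).toReal :=
    ENNReal.toReal_add (ne_top_of_le_ne_top ENNReal.one_ne_top r1)
      (ne_top_of_le_ne_top ENNReal.one_ne_top r2)
  have t1 : (indexRatio mn (ENNReal.ofReal S)).toReal ≤ 1 := by
    simpa using ENNReal.toReal_mono ENNReal.one_ne_top r1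
  have t2 : (indexRatio (ENNReal.ofReal S) mx).toReal ≤ 1 := by
    simpa using ENNReal.toReal_mono ENNReal.one_ne_top r2
  rw [e]
  refine ⟨by linarith, ?_⟩
  rcases hS0.eq_or_lt with h0 | hpos
  · rw [← h0]
    simp only [zero_mul, mul_zero, zero_sub, neg_nonpos]
    exact mul_nonneg ENNReal.toReal_nonneg hL.le
  · have hr : S * (indexRatio mn (ENNReal.ofReal S)).toReal = mn.toReal := by
      have : ¬ (mn = 0 ∧ ENNReal.ofReal S = 0) := fun h => by
        have := ENNReal.ofReal_eq_zero.1 h.2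
        linarith
      rw [indexRatio, if_neg this, ENNReal.toReal_div, ENNReal.toReal_ofReal hS0,
        mul_div_cancel₀ _ hpos.ne']
    rw [← hr]
    have h3 : 0 ≤ S * (v - u) := by positivity
    nlinarith

/-- A nonnegative lower bound for the slopes of `f` on `[u, v]` which controls the linear index. -/
def IsSlopeBound (f : ℝ → ℝ) (u v α : ℝ) : Prop :=
  0 ≤ α ∧ (∀ x y, u ≤ x → x ≤ y → y ≤ v → α * (y - x) ≤ |f y - f x|) ∧
    0 ≤ linearIndex f u v ∧ |f v - f u| - α * (v - u) ≤ 2 * |f v - f u| * linearIndex f u v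

/-- The case where the flat end is `u` (convex monotone or concave antitone). The derivative at `u`
is below every secant from `u`, hence below every secant, and the derivative at `v` is above the
full secant. `exists_slopeBound_of_right` is the mirror case. -/
theorem exists_slopeBound_of_left {f : ℝ → ℝ} {u v : ℝ} (huv : u < v)
    (hf : MonotoneOn f (Icc u v) ∨ AntitoneOn f (Icc u v))
    (h1 : ∀ s t, u < s → s < t → t ≤ v → |f s - f u| / (s - u) ≤ |f t - f u| / (t - u))
    (h2 : ∀ x y, u ≤ x → x < y → y ≤ v → |f y - f u| / (y - u) ≤ |f y - f x| / (y - x)) :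
    ∃ α, IsSlopeBound f u v α := by
  have hL : 0 < v - u := sub_pos.2 huv
  have habs : ∀ x y, x < y → |(f y - f x) / (y - x)| = |f y - f x| / (y - x) := fun x y h => by
    rw [abs_div, abs_of_pos (sub_pos.2 h)]
  have hr : ∀ t, u < t → t ≤ v →
      (rightDerivE f u).abs ≤ ENNReal.ofReal (|f t - f u| / (t - u)) := by
    intro t ht htv
    refine abs_limsup_coe_le ?_
    filter_upwards [Ioo_mem_nhdsGT ht] with s hs
    rw [slope_def_field, habs _ _ hs.1]
    exact h1 s t hs.1 hs.2 htv
  have hl : ENNReal.ofReal (|f v - f u| / (v - u)) ≤ (leftDerivE f v).abs := by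
    have key : ∀ᶠ t in 𝓝[<] v, t ∈ Ioo u v := Ioo_mem_nhdsLT huv
    have hb : ∀ t ∈ Ioo u v, |f v - f u| / (v - u) ≤ |f v - f t| / (v - t) := fun t ht =>
      h2 t v ht.1.le ht.2 le_rfl
    have hs : ∀ t, slope f v t = (f v - f t) / (v - t) := fun t => by
      rw [slope_comm, slope_def_field]
    refine le_abs_limsup_coe (hf.imp (fun hf => ?_) (fun hf => ?_))
    · filter_upwards [key] with t ht
      have h3 := hf ⟨ht.1.le, ht.2.le⟩ ⟨huv.le, le_rfl⟩ ht.2.le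
      have := hb t ht
      rwa [abs_of_nonneg (sub_nonneg.2 h3), ← hs] at this
    · filter_upwards [key] with t ht
      have h3 := hf ⟨ht.1.le, ht.2.le⟩ ⟨huv.le, le_rfl⟩ ht.2.le
      have := hb t ht
      rw [abs_of_nonpos (sub_nonpos.2 h3), neg_div, ← hs] at this
      linarith
  obtain ⟨h3, h4⟩ := linearIndex_bounds huv
    ((min_le_left _ _).trans (by rw [habs _ _ huv]; exact hr v huv le_rfl))
    (le_trans (by rw [habs _ _ huv]; exact hl) (le_max_right _ _))
  refine ⟨_, ENNReal.toReal_nonneg, fun x y hx hxy hy => ?_, h3, h4⟩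
  rcases hxy.eq_or_lt with rfl | hxy
  · simp
  have h5 := (min_le_left _ (leftDerivE f v).abs).trans (hr y (hx.trans_lt hxy) hy)
  have h6 := ENNReal.toReal_le_of_le_ofReal
    (div_nonneg (abs_nonneg _) (by linarith)) h5
  have := h6.trans (h2 x y hx hxy hy)
  rwa [le_div_iff₀ (sub_pos.2 hxy)] at this

theorem exists_slopeBound_of_right {f : ℝ → ℝ} {u v : ℝ} (huv : u < v)
    (hf : MonotoneOn f (Icc u v) ∨ AntitoneOn f (Icc u v))
    (h1 : ∀ s t, u ≤ s → s < t → t < v → |f v - f t| / (v - t) ≤ |f v - f s| / (v - s))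
    (h2 : ∀ x y, u ≤ x → x < y → y ≤ v → |f v - f x| / (v - x) ≤ |f y - f x| / (y - x)) :
    ∃ α, IsSlopeBound f u v α := by
  have hL : 0 < v - u := sub_pos.2 huv
  have habs : ∀ x y, x < y → |(f y - f x) / (y - x)| = |f y - f x| / (y - x) := fun x y h => by
    rw [abs_div, abs_of_pos (sub_pos.2 h)]
  have hr : ∀ s, u ≤ s → s < v →
      (leftDerivE f v).abs ≤ ENNReal.ofReal (|f v - f s| / (v - s)) := by
    intro s hus hsv
    refine abs_limsup_coe_le ?_
    filter_upwards [Ioo_mem_nhdsLT hsv] with t ht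
    rw [slope_comm, slope_def_field, habs _ _ ht.2]
    exact h1 s t hus ht.1 ht.2
  have hl : ENNReal.ofReal (|f v - f u| / (v - u)) ≤ (rightDerivE f u).abs := by
    have key : ∀ᶠ t in 𝓝[>] u, t ∈ Ioo u v := Ioo_mem_nhdsGT huv
    have hb : ∀ t ∈ Ioo u v, |f v - f u| / (v - u) ≤ |f t - f u| / (t - u) := fun t ht =>
      h2 u t le_rfl ht.1 ht.2.le
    refine le_abs_limsup_coe (hf.imp (fun hf => ?_) (fun hf => ?_))
    · filter_upwards [key] with t ht
      have h3 := hf ⟨le_rfl, huv.le⟩ ⟨ht.1.le, ht.2.le⟩ ht.1.le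
      have := hb t ht
      rwa [abs_of_nonneg (sub_nonneg.2 h3), ← slope_def_field] at this
    · filter_upwards [key] with t ht
      have h3 := hf ⟨le_rfl, huv.le⟩ ⟨ht.1.le, ht.2.le⟩ ht.1.le
      have := hb t ht
      rw [abs_of_nonpos (sub_nonpos.2 h3), neg_div, ← slope_def_field] at this
      linarith
  obtain ⟨h3, h4⟩ := linearIndex_bounds huv
    ((min_le_right _ _).trans (by rw [habs _ _ huv]; exact hr u le_rfl huv))
    (le_trans (by rw [habs _ _ huv]; exact hl) (le_max_left _ _))
  refine ⟨_, ENNReal.toReal_nonneg, fun x y hx hxy hy => ?_, h3, h4⟩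
  rcases hxy.eq_or_lt with rfl | hxy
  · simp
  have h5 := (min_le_right (rightDerivE f u).abs _).trans (hr x hx (hxy.trans_le hy))
  have h6 := ENNReal.toReal_le_of_le_ofReal
    (div_nonneg (abs_nonneg _) (by linarith)) h5
  have := h6.trans (h2 x y hx hxy hy)
  rwa [le_div_iff₀ (sub_pos.2 hxy)] at this

theorem ConvexOn.secant_le_secant_right {F : ℝ → ℝ} {S : Set ℝ} (hF : ConvexOn ℝ S F) {w x y : ℝ}
    (hw : w ∈ S) (hx : x ∈ S) (hy : y ∈ S) (hwx : w ≤ x) (hxy : x < y) :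
    (F y - F w) / (y - w) ≤ (F y - F x) / (y - x) := by
  have := hF.secant_mono hy hw hx (hwx.trans_lt hxy).ne hxy.ne hwx
  rwa [← neg_sub (F y), ← neg_sub y, neg_div_neg_eq, ← neg_sub (F y), ← neg_sub y,
    neg_div_neg_eq] at this

theorem exists_slopeBound {f : ℝ → ℝ} {u v : ℝ} (huv : u < v)
    (hf : MonotoneOn f (Icc u v) ∨ AntitoneOn f (Icc u v))
    (hc : ConvexOn ℝ (Icc u v) f ∨ ConcaveOn ℝ (Icc u v) f) : ∃ α, IsSlopeBound f u v α := by
  -- Only the secant inequalities are transferred to the convex function `F = ±f`; the index stays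
  -- attached to `f`, so its invariance under negation is not needed.
  obtain ⟨F, hF, hFc, habs⟩ : ∃ F : ℝ → ℝ, (MonotoneOn F (Icc u v) ∨ AntitoneOn F (Icc u v)) ∧
      ConvexOn ℝ (Icc u v) F ∧ ∀ x y, |f y - f x| = |F y - F x| := by
    rcases hc with hc | hc
    · exact ⟨f, hf, hc, fun _ _ => rfl⟩
    · refine ⟨fun x => -f x, hf.symm.imp (fun h => h.neg) (fun h => h.neg), hc.neg, fun x y => ?_⟩
      rw [show -f y - -f x = -(f y - f x) by ring, abs_neg]
  rcases hF with hF | hF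
  · have hp : ∀ x y, u ≤ x → x ≤ y → y ≤ v → |f y - f x| = F y - F x := fun x y h1 h2 h3 => by
      rw [habs]
      exact abs_of_nonneg (sub_nonneg.2 (hF ⟨h1, h2.trans h3⟩ ⟨h1.trans h2, h3⟩ h2))
    refine exists_slopeBound_of_left huv hf (fun s t hs hst ht => ?_) (fun x y hx hxy hy => ?_)
    · rw [hp _ _ le_rfl hs.le (hst.le.trans ht), hp _ _ le_rfl (hs.trans hst).le ht]
      exact hFc.secant_mono ⟨le_rfl, huv.le⟩ ⟨hs.le, hst.le.trans ht⟩ ⟨(hs.trans hst).le, ht⟩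
        hs.ne' (hs.trans hst).ne' hst.le
    · rw [hp _ _ le_rfl (hx.trans hxy.le) hy, hp _ _ hx hxy.le hy]
      exact ConvexOn.secant_le_secant_right hFc ⟨le_rfl, huv.le⟩ ⟨hx, hxy.le.trans hy⟩
        ⟨hx.trans hxy.le, hy⟩ hx hxy
  · have hp : ∀ x y, u ≤ x → x ≤ y → y ≤ v → |f y - f x| = -(F y - F x) :=
      fun x y h1 h2 h3 => by
        rw [habs]
        exact abs_of_nonpos (sub_nonpos.2 (hF ⟨h1, h2.trans h3⟩ ⟨h1.trans h2, h3⟩ h2))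
    refine exists_slopeBound_of_right huv hf (fun s t hs hst ht => ?_) (fun x y hx hxy hy => ?_)
    · rw [hp _ _ hs (hst.le.trans ht.le) le_rfl, hp _ _ (hs.trans hst.le) ht.le le_rfl,
        neg_div, neg_div, neg_le_neg_iff]
      exact ConvexOn.secant_le_secant_right hFc ⟨hs, (hst.trans ht).le⟩ ⟨hs.trans hst.le, ht.le⟩
        ⟨huv.le, le_rfl⟩ hst.le ht
    · rw [hp _ _ hx (hxy.le.trans hy) le_rfl, hp _ _ hx hxy.le hy, neg_div, neg_div,
        neg_le_neg_iff]
      exact hFc.secant_mono ⟨hx, hxy.le.trans hy⟩ ⟨hx.trans hxy.le, hy⟩ ⟨huv.le, le_rfl⟩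
        hxy.ne' (hxy.trans_le hy).ne' hy

/-! ### Partitions into intervals -/

theorem interval_geometry {J : Set ℝ} {a b : ℝ} (hO : J.OrdConnected) (hN : J.Nontrivial)
    (hs : J ⊆ Icc a b) :
    sInf J < sSup J ∧ Ioo (sInf J) (sSup J) ⊆ J ∧ J ⊆ Icc (sInf J) (sSup J) ∧
      closure J = Icc (sInf J) (sSup J) := by
  have hb : BddBelow J := bddBelow_Icc.mono hs
  have ha : BddAbove J := bddAbove_Icc.mono hs
  have h1 : Ioo (sInf J) (sSup J) ⊆ J :=
    IsConnected.Ioo_csInf_csSup_subset ⟨hN.nonempty, hO.isPreconnected⟩ hb ha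
  have h2 : J ⊆ Icc (sInf J) (sSup J) := subset_Icc_csInf_csSup hb ha
  obtain ⟨x, hx, y, hy, hxy⟩ := hN.exists_lt
  have h3 : sInf J < sSup J := ((h2 hx).1.trans_lt hxy).trans_le (h2 hy).2
  refine ⟨h3, h1, h2, (closure_minimal h2 isClosed_Icc).antisymm ?_⟩
  rw [← closure_Ioo h3.ne]
  exact closure_mono h1

theorem mem_closure_of_disjoint {J J' : Set ℝ} {a b x : ℝ} (hO : J.OrdConnected)
    (hN : J.Nontrivial) (hs : J ⊆ Icc a b) (hd : Disjoint J J') (hx : x ∈ J') (hxJ : x ∈ closure J) :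
    x = sInf J ∨ x = sSup J := by
  obtain ⟨-, h1, -, h2⟩ := interval_geometry hO hN hs
  rw [h2] at hxJ
  by_contra! hne
  exact disjoint_left.1 hd (h1 ⟨lt_of_le_of_ne hxJ.1 hne.1.symm, lt_of_le_of_ne hxJ.2 hne.2⟩) hx

theorem mem_of_mem_closure_disjoint {J J' : Set ℝ} {a b x : ℝ} (hO : J'.OrdConnected)
    (hN : J'.Nontrivial) (hs : J' ⊆ Icc a b) (hd : Disjoint J J') (hx : x ∈ J')
    (hxJ : x ∈ closure J) : x = sInf J' ∨ x = sSup J' := by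
  obtain ⟨-, h1, h2, -⟩ := interval_geometry hO hN hs
  by_contra! hne
  have hxo : x ∈ Ioo (sInf J') (sSup J') :=
    ⟨lt_of_le_of_ne (h2 hx).1 hne.1.symm, lt_of_le_of_ne (h2 hx).2 hne.2⟩
  obtain ⟨y, hy, hyJ⟩ := mem_closure_iff.1 hxJ _ isOpen_Ioo hxo
  exact disjoint_left.1 hd hyJ (h1 hy)

theorem IsMCCPartition.subset {a b : ℝ} {k : ℕ} {f : ℝ → ℝ} {P : Finset (Set ℝ)}
    (hP : IsMCCPartition a b k f P) {J : Set ℝ} (hJ : J ∈ P) : J ⊆ Icc a b := by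
  rw [← hP.2.2.2.1]
  exact subset_sUnion_of_mem hJ

theorem IsMCCPartition.exists_mem {a b : ℝ} {k : ℕ} {f : ℝ → ℝ} {P : Finset (Set ℝ)}
    (hP : IsMCCPartition a b k f P) {x : ℝ} (hx : x ∈ Icc a b) : ∃ J ∈ P, x ∈ J := by
  rw [← hP.2.2.2.1] at hx
  exact hx

theorem IsMCCPartition.geometry {a b : ℝ} {k : ℕ} {f : ℝ → ℝ} {P : Finset (Set ℝ)}
    (hP : IsMCCPartition a b k f P) {J : Set ℝ} (hJ : J ∈ P) :
    sInf J < sSup J ∧ Ioo (sInf J) (sSup J) ⊆ J ∧ J ⊆ Icc (sInf J) (sSup J) ∧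
      closure J = Icc (sInf J) (sSup J) :=
  interval_geometry (hP.2.1 J hJ).1 (hP.2.1 J hJ).2 (hP.subset hJ)

/-- A point of one interval that lies in the closure of another is an endpoint of both, where both
local functions equal `f`. The choice of the interval is therefore immaterial. -/
theorem IsMCCPartition.exists_glue {a b : ℝ} {k : ℕ} {f : ℝ → ℝ} {P : Finset (Set ℝ)}
    (hP : IsMCCPartition a b k f P) (g : Set ℝ → ℝ → ℝ)
    (hg : ∀ J ∈ P, g J (sInf J) = f (sInf J) ∧ g J (sSup J) = f (sSup J)) :
    ∃ F : ℝ → ℝ, ∀ J ∈ P, EqOn F (g J) (closure J) := by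
  classical
  refine ⟨fun x => if h : ∃ J ∈ P, x ∈ J then g h.choose x else f x, fun J hJ x hx => ?_⟩
  have hxab : x ∈ Icc a b := closure_minimal (hP.subset hJ) isClosed_Icc hx
  have h : ∃ J ∈ P, x ∈ J := hP.exists_mem hxab
  simp only [dif_pos h]
  obtain ⟨hJ', hx'⟩ := h.choose_spec
  generalize h.choose = J' at hJ' hx'
  by_cases e : J = J'
  · rw [e]
  have hd : Disjoint J J' := hP.2.2.1 hJ hJ' e
  have h1 := mem_closure_of_disjoint (hP.2.1 J hJ).1 (hP.2.1 J hJ).2 (hP.subset hJ) hd hx' hx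
  have h2 := mem_of_mem_closure_disjoint (hP.2.1 J' hJ').1 (hP.2.1 J' hJ').2 (hP.subset hJ') hd
    hx' hx
  have e1 : g J x = f x := by
    rcases h1 with rfl | rfl
    · exact (hg J hJ).1
    · exact (hg J hJ).2
  have e2 : g J' x = f x := by
    rcases h2 with rfl | rfl
    · exact (hg J' hJ').1
    · exact (hg J' hJ').2
  rw [e1, e2]

theorem IsMCCPartition.biUnion_closure {a b : ℝ} {k : ℕ} {f : ℝ → ℝ} {P : Finset (Set ℝ)}
    (hP : IsMCCPartition a b k f P) : ⋃ J : P, closure (J : Set ℝ) = Icc a b := by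
  refine Subset.antisymm (iUnion_subset fun J => closure_minimal (hP.subset J.2) isClosed_Icc)
    fun x hx => ?_
  obtain ⟨J, hJ, hxJ⟩ := hP.exists_mem hx
  exact mem_iUnion.2 ⟨⟨J, hJ⟩, subset_closure hxJ⟩

theorem IsMCCPartition.congr {a b : ℝ} {k : ℕ} {f F : ℝ → ℝ} {P : Finset (Set ℝ)}
    (hP : IsMCCPartition a b k f P) (g : Set ℝ → ℝ → ℝ)
    (hF : ∀ J ∈ P, EqOn F (g J) (closure J))
    (hg : ∀ J ∈ P, Continuous (g J) ∧ (Monotone (g J) ∨ Antitone (g J)) ∧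
      (ConvexOn ℝ univ (g J) ∨ ConcaveOn ℝ univ (g J))) :
    ContinuousOn F (Icc a b) ∧ IsMCCPartition a b k F P := by
  constructor
  · rw [← hP.biUnion_closure]
    exact (locallyFinite_of_finite _).continuousOn_iUnion (fun _ => isClosed_closure)
      fun J => (hg J J.2).1.continuousOn.congr (hF J J.2)
  · refine ⟨hP.1, hP.2.1, hP.2.2.1, hP.2.2.2.1, fun J hJ => ?_⟩
    have hcv : Convex ℝ (closure J) := (hP.2.1 J hJ).1.convex.closure
    refine ⟨(hg J hJ).2.1.imp (fun h => ?_) (fun h => ?_),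
      (hg J hJ).2.2.imp (fun h => ?_) (fun h => ?_)⟩
    · exact (h.monotoneOn _).congr (hF J hJ).symm
    · exact (h.antitoneOn _).congr (hF J hJ).symm
    · exact (h.subset (subset_univ _) hcv).congr (hF J hJ).symm
    · exact (h.subset (subset_univ _) hcv).congr (hF J hJ).symm

/-- The endpoints need not belong to `J`; by continuity their values lie in the closure of `f '' J`.
-/
theorem abs_sub_le_variationOn {f : ℝ → ℝ} {J : Set ℝ} {a b : ℝ} (hO : J.OrdConnected)
    (hN : J.Nontrivial) (hs : J ⊆ Icc a b) (hf : ContinuousOn f (Icc a b)) :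
    |f (sSup J) - f (sInf J)| ≤ variationOn f J := by
  obtain ⟨h1, -, -, h2⟩ := interval_geometry hO hN hs
  have hcl : closure J ⊆ Icc a b := closure_minimal hs isClosed_Icc
  have hK : IsCompact (f '' Icc a b) := isCompact_Icc.image_of_continuousOn hf
  have hsub : f '' J ⊆ f '' Icc a b := image_mono hs
  have ha : BddAbove (f '' J) := hK.bddAbove.mono hsub
  have hb : BddBelow (f '' J) := hK.bddBelow.mono hsub
  have key : ∀ x ∈ closure J, f x ∈ Icc (sInf (f '' J)) (sSup (f '' J)) := by
    intro x hx
    have hx' : f x ∈ closure (f '' J) :=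
      (hf.mono hcl).image_closure (mem_image_of_mem f hx)
    exact closure_minimal (subset_Icc_csInf_csSup hb ha) isClosed_Icc hx'
  have hu := key (sInf J) (by rw [h2]; exact ⟨le_rfl, h1.le⟩)
  have hv := key (sSup J) (by rw [h2]; exact ⟨h1.le, le_rfl⟩)
  unfold variationOn
  rw [abs_le]
  constructor <;> linarith [hu.1, hu.2, hv.1, hv.2]

/-! ### Vapnik-Chervonenkis bounds from piecewise convexity -/

/-- A set cutting out every other point of `B` alternates on `K + 1` successive blocks of four
points. No block fits inside a single `I ∩ I'`, so each one leaves the `P`-interval or the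
`Q`-interval of its first point, and no interval can be left by two blocks. -/
theorem vcDimLE_of_ordConnected_pieces {α : Type*} [LinearOrder α] {y : α → ℝ}
    (hy : StrictMono y) {A : Set (Set α)} {K : ℕ}
    (hA : ∀ S ∈ A, ∃ P Q : Finset (Set ℝ), P.card + Q.card ≤ K ∧
      (∀ I ∈ P, I.OrdConnected) ∧ (∀ I ∈ Q, I.OrdConnected) ∧
      (∀ w, ∃ I ∈ P, y w ∈ I) ∧ (∀ w, ∃ I ∈ Q, y w ∈ I) ∧
      ∀ I ∈ P, ∀ I' ∈ Q, ∀ w : Fin 4 → α, StrictMono w → (∀ j, y (w j) ∈ I ∩ I') →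
        w 0 ∈ S → w 1 ∉ S → w 2 ∈ S → w 3 ∉ S → False) :
    VCDimLE A (4 * (K + 1)) := by
  classical
  intro B hB
  set e := B.orderEmbOfFin rfl with he
  -- The subset that cannot be cut out consists of the points of even rank.
  refine ⟨{z | ∃ i : Fin B.card, Even (i : ℕ) ∧ z = e i}, ?_, fun S hS hBS => ?_⟩
  · rintro z ⟨i, -, rfl⟩
    exact B.orderEmbOfFin_mem rfl i
  obtain ⟨P, Q, hcard, hP, hQ, hPc, hQc, halt⟩ := hA S hS
  choose c hc hyc using hPc
  choose d hd hyd using hQc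
  have hmem : ∀ i : Fin B.card, e i ∈ S ↔ Even (i : ℕ) := fun i => by
    have hi : e i ∈ (B : Set α) := B.orderEmbOfFin_mem rfl i
    have h1 : e i ∈ (B : Set α) ∩ S ↔ ∃ j : Fin B.card, Even (j : ℕ) ∧ e i = e j := by
      rw [hBS]; rfl
    constructor
    · intro h
      obtain ⟨j, hj, hij⟩ := h1.1 ⟨hi, h⟩
      rwa [e.injective hij]
    · exact fun h => (h1.2 ⟨i, h, rfl⟩).2
  let p : Fin (K + 1) → Fin 4 → Fin B.card := fun g j => ⟨4 * g + j, by omega⟩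
  have hpm : ∀ g, StrictMono (p g) := fun g i j hij => by
    simp only [p, Fin.lt_def] at hij ⊢; omega
  have hpar : ∀ g j, Even (p g j : ℕ) ↔ Even (j : ℕ) := fun g j => by
    have h4 : Even 4 := by decide
    simp [p, Nat.even_add, h4]
  -- `φ g` is the interval left by block `g`: the `P`-interval of its first point if some point
  -- falls outside it, otherwise the `Q`-interval.
  let φ : Fin (K + 1) → Set ℝ ⊕ Set ℝ := fun g =>
    if ∀ j, y (e (p g j)) ∈ c (e (p g 0)) then Sum.inr (d (e (p g 0)))
    else Sum.inl (c (e (p g 0)))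
  have hφ : ∀ g ∈ (Finset.univ : Finset (Fin (K + 1))), φ g ∈ P.disjSum Q := fun g _ => by
    simp only [φ]
    split_ifs
    · exact Finset.inr_mem_disjSum.2 (hd _)
    · exact Finset.inl_mem_disjSum.2 (hc _)
  obtain ⟨g, -, g', -, hne, heq⟩ := Finset.exists_ne_map_eq_of_card_lt_of_maps_to
    (by rw [Finset.card_disjSum, Finset.card_univ, Fintype.card_fin]; omega) hφ
  have key : ∀ g g' : Fin (K + 1), g < g' → φ g = φ g' → False := by
    intro g g' hlt heq
    -- If `φ g = φ g'`, the common interval contains the first points of both blocks, hence all of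
    -- block `g` between them, which contradicts that `g` leaves it.
    have hle : ∀ j, y (e (p g j)) ∈ Icc (y (e (p g 0))) (y (e (p g' 0))) := fun j =>
      ⟨hy.monotone (e.monotone ((hpm g).monotone (Fin.zero_le j))),
        hy.monotone (e.monotone (by
          simp only [p, Fin.le_def, Fin.lt_def] at hlt ⊢
          have := j.2
          simp only [Fin.val_zero]
          omega))⟩
    by_cases h : ∀ j, y (e (p g j)) ∈ c (e (p g 0))
    · have h1 : φ g = Sum.inr (d (e (p g 0))) := if_pos h
      have h2 : d (e (p g' 0)) = d (e (p g 0)) := by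
        by_cases h' : ∀ j, y (e (p g' j)) ∈ c (e (p g' 0))
        · have : φ g' = Sum.inr (d (e (p g' 0))) := if_pos h'
          rw [h1, this] at heq
          exact (Sum.inr.inj heq).symm
        · have : φ g' = Sum.inl (c (e (p g' 0))) := if_neg h'
          rw [h1, this] at heq
          exact absurd heq (by simp)
      have h3 : ∀ j, y (e (p g j)) ∈ d (e (p g 0)) := fun j =>
        (hQ _ (hd _)).out (hyd _) (h2 ▸ hyd (e (p g' 0))) (hle j)
      refine halt _ (hc (e (p g 0))) _ (hd (e (p g 0))) (fun j => e (p g j))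
        (e.strictMono.comp (hpm g)) (fun j => ⟨h j, h3 j⟩) ?_ ?_ ?_ ?_ <;>
        rw [hmem, hpar] <;> decide
    · have h1 : φ g = Sum.inl (c (e (p g 0))) := if_neg h
      have h2 : c (e (p g' 0)) = c (e (p g 0)) := by
        by_cases h' : ∀ j, y (e (p g' j)) ∈ c (e (p g' 0))
        · have : φ g' = Sum.inr (d (e (p g' 0))) := if_pos h'
          rw [h1, this] at heq
          exact absurd heq (by simp)
        · have : φ g' = Sum.inl (c (e (p g' 0))) := if_neg h'
          rw [h1, this] at heq
          exact (Sum.inl.inj heq).symm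
      exact h fun j => (hP _ (hc _)).out (hyc _) (h2 ▸ hyc (e (p g' 0))) (hle j)
  rcases lt_or_gt_of_ne hne with h | h
  · exact key g g' h heq
  · exact key g' g h heq.symm

theorem convexOn_affine_combo {f : ℝ → ℝ} {C : Set ℝ} (hf : ConvexOn ℝ C f) {x y z : ℝ} (A B : ℝ)
    (hx : x ∈ C) (hz : z ∈ C) (hxy : x < y) (hyz : y < z) :
    (f y - (A + B * y)) * (z - x) ≤
      (f x - (A + B * x)) * (z - y) + (f z - (A + B * z)) * (y - x) := by
  have h := hf.slope_mono_adjacent hx hz hxy hyz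
  rw [div_le_div_iff₀ (by linarith) (by linarith)] at h
  nlinarith

/-- A convex function that is nonpositive at two points cannot be positive between them. With the
affine function subtracted, the convex case uses the last three points and the concave case the
first three. -/
theorem not_alternating_superlevel {f : ℝ → ℝ} {C : Set ℝ}
    (hf : ConvexOn ℝ C f ∨ ConcaveOn ℝ C f) {A B : ℝ} {w : Fin 4 → ℝ} (hw : StrictMono w)
    (hC : ∀ j, w j ∈ C) (h0 : A + B * w 0 < f (w 0)) (h1 : f (w 1) ≤ A + B * w 1)
    (h2 : A + B * w 2 < f (w 2)) (h3 : f (w 3) ≤ A + B * w 3) : False := by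
  have l1 : w 0 < w 1 := hw (by decide)
  have l2 : w 1 < w 2 := hw (by decide)
  have l3 : w 2 < w 3 := hw (by decide)
  rcases hf with hf | hf
  · have := convexOn_affine_combo hf A B (hC 1) (hC 3) l2 l3
    have p1 : 0 < (f (w 2) - (A + B * w 2)) * (w 3 - w 1) :=
      mul_pos (by linarith) (by linarith)
    have p2 : (f (w 1) - (A + B * w 1)) * (w 3 - w 2) ≤ 0 :=
      mul_nonpos_of_nonpos_of_nonneg (by linarith) (by linarith)
    have p3 : (f (w 3) - (A + B * w 3)) * (w 2 - w 1) ≤ 0 :=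
      mul_nonpos_of_nonpos_of_nonneg (by linarith) (by linarith)
    linarith
  · have := convexOn_affine_combo hf.neg (-A) (-B) (hC 0) (hC 2) l1 l2
    simp only [Pi.neg_apply] at this
    have p1 : (f (w 1) - (A + B * w 1)) * (w 2 - w 0) ≤ 0 :=
      mul_nonpos_of_nonpos_of_nonneg (by linarith) (by linarith)
    have p2 : 0 < (f (w 0) - (A + B * w 0)) * (w 2 - w 1) :=
      mul_pos (by linarith) (by linarith)
    have p3 : 0 < (f (w 2) - (A + B * w 2)) * (w 1 - w 0) :=
      mul_pos (by linarith) (by linarith)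
    linarith

theorem not_alternating_sublevel {f : ℝ → ℝ} {C : Set ℝ}
    (hf : ConvexOn ℝ C f ∨ ConcaveOn ℝ C f) {A B : ℝ} {w : Fin 4 → ℝ} (hw : StrictMono w)
    (hC : ∀ j, w j ∈ C) (h0 : f (w 0) < A + B * w 0) (h1 : A + B * w 1 ≤ f (w 1))
    (h2 : f (w 2) < A + B * w 2) (h3 : A + B * w 3 ≤ f (w 3)) : False := by
  refine not_alternating_superlevel (f := fun x => -f x) (A := -A) (B := -B) (C := C)
    (hf.symm.imp (fun h => h.neg) (fun h => h.neg)) hw hC ?_ ?_ ?_ ?_ <;> linarith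

theorem isExtremal_of_affine_pieces {a b : ℝ} {k n N : ℕ} {x : Fin n → ℝ}
    (hx : ∀ i, x i ∈ Icc a b) {F : ℝ → ℝ} (hF : F ∈ mccClass a b k) {Q : Finset (Set ℝ)}
    (hQN : Q.card ≤ N) (hQO : ∀ I ∈ Q, I.OrdConnected) (hQc : ∀ t ∈ Icc a b, ∃ I ∈ Q, t ∈ I)
    (hQa : ∀ I ∈ Q, ∃ A B : ℝ, ∀ t ∈ I, F t = A + B * t) :
    F ∈ extremalSet x (mccClass a b k) (4 * (k + N + 1)) := by
  have hmemab : ∀ w : Set.range x, (w : ℝ) ∈ Icc a b := by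
    rintro ⟨_, i, rfl⟩
    exact hx i
  refine ⟨hF, mem_image_of_mem _ hF, by omega, ?_, ?_⟩
  all_goals
    refine vcDimLE_of_ordConnected_pieces (y := fun w : Set.range x => (w : ℝ))
      (fun _ _ h => h) ?_
    rintro S ⟨_, ⟨f, ⟨-, P, hP⟩, rfl⟩, rfl⟩
    refine ⟨P, Q, by have := hP.1; omega, fun I hI => (hP.2.1 I hI).1, hQO,
      fun w => hP.exists_mem (hmemab w), fun w => hQc _ (hmemab w), ?_⟩
    intro I hI I' hI' w hw hwI h0 h1 h2 h3
    obtain ⟨A, B, hAB⟩ := hQa I' hI'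
    simp only [mem_ofPred_eq, Set.domRestrict_apply, not_lt] at h0 h1 h2 h3
    rw [hAB _ (hwI _).2] at h0 h1 h2 h3
  · exact not_alternating_superlevel (w := fun j => (w j : ℝ)) (hP.2.2.2.2 I hI).2
      (fun i j h => hw h) (fun j => subset_closure (hwI j).1) h0 h1 h2 h3
  · exact not_alternating_sublevel (w := fun j => (w j : ℝ)) (hP.2.2.2.2 I hI).2
      (fun i j h => hw h) (fun j => subset_closure (hwI j).1) h0 h1 h2 h3

/-! ### Equispaced designs -/

theorem IsEquispaced.sub_eq {a b : ℝ} {n : ℕ} {x : Fin n → ℝ} (hx : IsEquispaced a b x)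
    (i j : Fin n) : x j - x i = ((j : ℝ) - (i : ℝ)) * ((b - a) / n) := by
  have key : ∀ (l : ℕ) (hl : l < n), x ⟨l, hl⟩ - x ⟨0, by omega⟩ = (l : ℝ) * ((b - a) / n) := by
    intro l
    induction l with
    | zero => intro _; simp
    | succ l ih =>
      intro hl
      have h1 := ih (by omega)
      have h2 := hx.2 ⟨l, by omega⟩ ⟨l + 1, hl⟩ rfl
      push_cast
      linarith
  have h1 := key i i.2
  have h2 := key j j.2
  simp only [Fin.eta] at h1 h2
  linarith

theorem IsEquispaced.spread {a b : ℝ} (hab : a < b) {n : ℕ} {x : Fin n → ℝ}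
    (hx : IsEquispaced a b x) (X : Finset (Fin n)) : Spread ((b - a) / n) X x := by
  intro c d hcd
  rcases Nat.eq_zero_or_pos n with rfl | hn
  · simp [Finset.eq_empty_of_isEmpty]
  have hh : 0 < (b - a) / n := div_pos (sub_pos.2 hab) (by exact_mod_cast hn)
  set S := X.filter fun j => c ≤ x j ∧ x j ≤ d with hS
  rcases S.eq_empty_or_nonempty with h | h
  · rw [h]
    simp only [Finset.card_empty, Nat.cast_zero]
    have := div_nonneg (sub_nonneg.2 hcd) hh.le
    linarith
  · have hsub : S ⊆ Finset.Icc (S.min' h) (S.max' h) := fun i hi =>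
      Finset.mem_Icc.2 ⟨S.min'_le i hi, S.le_max' i hi⟩
    have hcard := Finset.card_le_card hsub
    rw [Fin.card_Icc] at hcard
    have hmin := (Finset.mem_filter.1 (S.min'_mem h)).2
    have hmax := (Finset.mem_filter.1 (S.max'_mem h)).2
    have hle : (S.min' h : ℕ) ≤ (S.max' h : ℕ) := S.min'_le _ (S.max'_mem h)
    have h1 := hx.sub_eq (S.min' h) (S.max' h)
    have h2 : ((S.card : ℕ) : ℝ) ≤ ((S.max' h : ℕ) : ℝ) + 1 - ((S.min' h : ℕ) : ℝ) := by
      have : S.card + (S.min' h : ℕ) ≤ (S.max' h : ℕ) + 1 := by omega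
      have : ((S.card + (S.min' h : ℕ) : ℕ) : ℝ) ≤ (((S.max' h : ℕ) + 1 : ℕ) : ℝ) := by
        exact_mod_cast this
      push_cast at this
      linarith
    have h3 : ((S.max' h : ℕ) : ℝ) - ((S.min' h : ℕ) : ℝ) ≤ (d - c) / ((b - a) / n) := by
      rw [le_div_iff₀ hh, ← h1]
      linarith [hmin.1, hmax.2]
    linarith

/-- `J` extends at most one step `h` beyond its extreme design points, so its length is at most
`(n_J + 1) h ≤ 2 n_J h`, as `n_J ≥ 1`. -/
theorem IsEquispaced.length_le {a b : ℝ} (hab : a < b) {n : ℕ} {x : Fin n → ℝ}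
    (hx : IsEquispaced a b x) {J : Set ℝ} (hO : J.OrdConnected) (hN : J.Nontrivial)
    (hs : J ⊆ Icc a b) (hne : ∃ i, x i ∈ J) :
    sSup J - sInf J ≤ 2 * (designCount x J : ℝ) * ((b - a) / n) := by
  classical
  obtain ⟨i₀, hi₀⟩ := hne
  have hn : 0 < n := i₀.pos
  have hn' : (0 : ℝ) < n := by exact_mod_cast hn
  set h : ℝ := (b - a) / n with hh
  have hpos : 0 < h := div_pos (sub_pos.2 hab) hn'
  have hnh : n * h = b - a := by rw [hh]; field_simp
  set S : Finset (Fin n) := Finset.univ.filter fun i => x i ∈ J with hS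
  have hcount : designCount x J = S.card := by
    rw [designCount, ← Set.ncard_coe_finset]
    congr 1
    ext i
    simp [hS]
  have hSne : S.Nonempty := ⟨i₀, by simp [hS, hi₀]⟩
  set p := S.min' hSne with hp
  set q := S.max' hSne with hq
  have hpJ : x p ∈ J := (Finset.mem_filter.1 (S.min'_mem hSne)).2
  have hqJ : x q ∈ J := (Finset.mem_filter.1 (S.max'_mem hSne)).2
  have hpq : p ≤ q := S.min'_le _ (S.max'_mem hSne)
  have hsub : Finset.Icc p q ⊆ S := fun i hi => by
    have hi := Finset.mem_Icc.1 hi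
    refine Finset.mem_filter.2 ⟨Finset.mem_univ _, hO.out hpJ hqJ ⟨?_, ?_⟩⟩
    · have := hx.sub_eq p i
      have h1 : ((p : ℕ) : ℝ) ≤ ((i : ℕ) : ℝ) := by exact_mod_cast hi.1
      nlinarith
    · have := hx.sub_eq i q
      have h1 : ((i : ℕ) : ℝ) ≤ ((q : ℕ) : ℝ) := by exact_mod_cast hi.2
      nlinarith
  have hcard := Finset.card_le_card hsub
  rw [Fin.card_Icc] at hcard
  have hlow : x p - h ≤ sInf J := by
    -- With no design point to the left, the last point `x 0 + (n - 1) h ≤ b` gives `x 0 - h ≤ a`.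
    rcases Nat.eq_zero_or_pos (p : ℕ) with h0 | h0
    · have h1 := hx.sub_eq p ⟨n - 1, by omega⟩
      have h2 := (hx.1 ⟨n - 1, by omega⟩).2
      have h3 : a ≤ sInf J := le_csInf hN.nonempty fun t ht => (hs ht).1
      rw [h0] at h1
      simp only [Nat.cast_zero, sub_zero] at h1
      rw [Nat.cast_sub (by omega)] at h1
      push_cast at h1
      nlinarith
    · have hlt : (p : ℕ) - 1 < n := by omega
      have h1 := hx.sub_eq ⟨(p : ℕ) - 1, hlt⟩ p
      have h2 : x ⟨(p : ℕ) - 1, hlt⟩ ∉ J := fun hmem => by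
        have := S.min'_le ⟨(p : ℕ) - 1, hlt⟩ (by simp [hS, hmem])
        rw [← hp, Fin.le_def] at this
        simp only at this
        omega
      simp only at h1
      rw [Nat.cast_sub (by omega)] at h1
      push_cast at h1
      refine le_csInf hN.nonempty fun t ht => ?_
      by_contra! hc
      refine h2 (hO.out ht hpJ ⟨?_, ?_⟩) <;> nlinarith
  have hupp : sSup J ≤ x q + h := by
    rcases Nat.lt_or_ge ((q : ℕ) + 1) n with h0 | h0
    · have h1 := hx.sub_eq q ⟨(q : ℕ) + 1, h0⟩
      have h2 : x ⟨(q : ℕ) + 1, h0⟩ ∉ J := fun hmem => by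
        have := S.le_max' ⟨(q : ℕ) + 1, h0⟩ (by simp [hS, hmem])
        rw [← hq, Fin.le_def] at this
        simp only at this
        omega
      push_cast at h1
      refine csSup_le hN.nonempty fun t ht => ?_
      by_contra! hc
      refine h2 (hO.out hqJ ht ⟨?_, ?_⟩) <;> nlinarith
    · have hq1 : (q : ℕ) + 1 = n := by have := q.2; omega
      have h1 := hx.sub_eq ⟨0, hn⟩ q
      have h2 := (hx.1 ⟨0, hn⟩).1
      have h3 : sSup J ≤ b := csSup_le hN.nonempty fun t ht => (hs ht).2
      have h4 : ((q : ℕ) : ℝ) = n - 1 := by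
        have : (((q : ℕ) + 1 : ℕ) : ℝ) = n := by rw [hq1]
        push_cast at this
        linarith
      simp only [Nat.cast_zero, sub_zero] at h1
      rw [h4] at h1
      nlinarith
  have h1 := hx.sub_eq p q
  have h2 : ((q : ℕ) : ℝ) + 1 - ((p : ℕ) : ℝ) ≤ S.card := by
    have hle : (p : ℕ) ≤ (q : ℕ) := hpq
    have : (q : ℕ) + 1 ≤ S.card + (p : ℕ) := by omega
    have : (((q : ℕ) + 1 : ℕ) : ℝ) ≤ ((S.card + (p : ℕ) : ℕ) : ℝ) := by exact_mod_cast this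
    push_cast at this
    linarith
  have h3 : (1 : ℝ) ≤ S.card := by exact_mod_cast hSne.card_pos
  rw [hcount]
  nlinarith

/-! ### Approximation by extremal elements and optimisation -/

theorem sum_le_sum_sum_filter {ι : Type*} [Fintype ι] {P : Finset (Set ℝ)} {x : ι → ℝ} {e : ι → ℝ}
    (he : ∀ i, 0 ≤ e i) (hx : ∀ i, ∃ J ∈ P, x i ∈ J) [∀ J : Set ℝ, DecidablePred fun i => x i ∈ J] :
    ∑ i, e i ≤ ∑ J ∈ P, ∑ i ∈ Finset.univ.filter (fun i => x i ∈ J), e i := by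
  simp only [Finset.sum_filter]
  rw [Finset.sum_comm]
  refine Finset.sum_le_sum fun i _ => ?_
  obtain ⟨J, hJ, hi⟩ := hx i
  refine le_trans (by rw [if_pos hi]) (Finset.single_le_sum
    (f := fun J => if x i ∈ J then e i else 0) (fun J _ => ?_) hJ)
  split_ifs
  · exact he i
  · exact le_rfl

theorem exists_extremal_approx {a b : ℝ} (hab : a < b) {k n : ℕ} (hn : 0 < n) {x : Fin n → ℝ}
    (hx : IsEquispaced a b x) {f : ℝ → ℝ} (hf : ContinuousOn f (Icc a b)) {P : Finset (Set ℝ)}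
    (hP : IsMCCPartition a b k f P) {M : Set ℝ → ℕ} (hM : ∀ J, 0 < M J) :
    ∃ F ∈ extremalSet x (mccClass a b k) (4 * (k + ∑ J ∈ P, M J + 1)),
      loss x f F ≤ 16 * ∑ J ∈ P, ((designCount x J : ℝ) * variationOn f J *
        linearIndex f (sInf J) (sSup J)) / n / (M J : ℝ) ^ 2 + totalVariation f P / n := by
  classical
  have hex : ∀ J, ∃ (α : ℝ) (g : ℝ → ℝ) (I : ℕ → Set ℝ), J ∈ P →
      IsSlopeBound f (sInf J) (sSup J) α ∧ IsInterpolant f (sInf J) (sSup J)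
        (|f (sSup J) - f (sInf J)| - α * (sSup J - sInf J)) (M J) g I := by
    intro J
    by_cases hJ : J ∈ P
    · obtain ⟨h1, -, -, h2⟩ := hP.geometry hJ
      obtain ⟨h3, h4⟩ := hP.2.2.2.2 J hJ
      rw [h2] at h3 h4
      obtain ⟨α, hα⟩ := exists_slopeBound h1 h3 h4
      obtain ⟨g, I, hg⟩ := exists_interpolant h1 hα.1 h3 h4 hα.2.1 (hM J)
      exact ⟨α, g, I, fun _ => ⟨hα, hg⟩⟩
    · exact ⟨0, 0, fun _ => ∅, fun h => absurd h hJ⟩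
  choose α g I h using hex
  obtain ⟨F, hF⟩ := hP.exists_glue g fun J hJ =>
    ⟨(h J hJ).2.2.2.2.2.2.2.1, (h J hJ).2.2.2.2.2.2.2.2.1⟩
  obtain ⟨hFc, hFP⟩ := hP.congr g hF fun J hJ =>
    ⟨(h J hJ).2.1, (h J hJ).2.2.1, (h J hJ).2.2.2.1⟩
  -- The cells are intersected with `J` because `F` agrees with `g J` only on the closure of `J`.
  refine ⟨F, isExtremal_of_affine_pieces hx.1 ⟨hFc, P, hFP⟩
    (Q := P.biUnion fun J => (Finset.range (M J)).image fun i => J ∩ I J i) ?_ ?_ ?_ ?_, ?_⟩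
  · exact Finset.card_biUnion_le.trans (Finset.sum_le_sum fun J _ =>
      Finset.card_image_le.trans (Finset.card_range _).le)
  · intro Z hZ
    simp only [Finset.mem_biUnion, Finset.mem_image] at hZ
    obtain ⟨J, hJ, i, -, rfl⟩ := hZ
    exact (hP.2.1 J hJ).1.inter ((h J hJ).2.2.2.2.1 i)
  · intro t ht
    obtain ⟨J, hJ, htJ⟩ := hP.exists_mem ht
    obtain ⟨i, hi, hti⟩ := (h J hJ).2.2.2.2.2.1 t ((hP.geometry hJ).2.2.1 htJ)
    exact ⟨J ∩ I J i, Finset.mem_biUnion.2 ⟨J, hJ, Finset.mem_image.2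
      ⟨i, Finset.mem_range.2 hi, rfl⟩⟩, htJ, hti⟩
  · intro Z hZ
    simp only [Finset.mem_biUnion, Finset.mem_image, Finset.mem_range] at hZ
    obtain ⟨J, hJ, i, hi, rfl⟩ := hZ
    obtain ⟨A, B, hAB⟩ := (h J hJ).2.2.2.2.2.2.1 i hi
    exact ⟨A, B, fun t ht => (hF J hJ (subset_closure ht.1)).trans (hAB t ht.2)⟩
  · have hn' : (0 : ℝ) < n := by exact_mod_cast hn
    have hh : 0 < (b - a) / n := div_pos (sub_pos.2 hab) hn'
    have hpiece : ∀ J ∈ P, ∑ i ∈ Finset.univ.filter (fun i => x i ∈ J), |f (x i) - F (x i)| ≤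
        16 * ((designCount x J : ℝ) * variationOn f J * linearIndex f (sInf J) (sSup J) /
          (M J : ℝ) ^ 2) + variationOn f J := by
      intro J hJ
      obtain ⟨⟨-, -, hΓ, hE⟩, hI⟩ := h J hJ
      obtain ⟨huv, -, hsub, -⟩ := hP.geometry hJ
      have hV := abs_sub_le_variationOn (hP.2.1 J hJ).1 (hP.2.1 J hJ).2 (hP.subset hJ) hf
      have hV0 : 0 ≤ variationOn f J := (abs_nonneg _).trans hV
      -- Without design points in `J` the length bound fails, but the sum is empty.
      rcases (Finset.univ.filter fun i => x i ∈ J).eq_empty_or_nonempty with h0 | h0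
      · rw [h0, Finset.sum_empty]
        positivity
      obtain ⟨i, hi⟩ := h0
      have hlen := hx.length_le hab (hP.2.1 J hJ).1 (hP.2.1 J hJ).2 (hP.subset hJ)
        ⟨i, (Finset.mem_filter.1 hi).2⟩
      have hm : (0 : ℝ) < M J := by exact_mod_cast hM J
      calc _ = ∑ i ∈ Finset.univ.filter (fun i => x i ∈ J), |f (x i) - g J (x i)| :=
            Finset.sum_congr rfl fun i hi => by
              rw [hF J hJ (subset_closure (Finset.mem_filter.1 hi).2)]
        _ ≤ _ := hI.2.2.2.2.2.2.2.2 _ hh n _ x (hx.spread hab _) fun i hi =>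
              hsub (Finset.mem_filter.1 hi).2
        _ ≤ _ := by
            -- The constant is `16 = 4 · 2 · 2`: interpolation, length of `J`, linear index.
            refine add_le_add ?_ hV
            rw [div_le_iff₀ (by positivity)]
            have e1 : 16 * ((designCount x J : ℝ) * variationOn f J *
                linearIndex f (sInf J) (sSup J) / (M J : ℝ) ^ 2) * ((M J : ℝ) ^ 2 * ((b - a) / n)) =
                4 * (2 * (designCount x J : ℝ) * ((b - a) / n)) *
                  (2 * variationOn f J * linearIndex f (sInf J) (sSup J)) := by
              field_simp
              ring
            rw [e1]
            have hL : 0 ≤ sSup J - sInf J := by linarith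
            have hE2 : |f (sSup J) - f (sInf J)| - α J * (sSup J - sInf J) ≤
                2 * variationOn f J * linearIndex f (sInf J) (sSup J) :=
              hE.trans (by gcongr)
            calc _ ≤ 4 * (sSup J - sInf J) *
                  (2 * variationOn f J * linearIndex f (sInf J) (sSup J)) := by gcongr
              _ ≤ _ := by gcongr
    have hsum := (sum_le_sum_sum_filter (P := P) (e := fun i => |f (x i) - F (x i)|)
      (fun _ => abs_nonneg _) fun i => hP.exists_mem (hx.1 i)).trans (Finset.sum_le_sum hpiece)
    rw [loss]
    calc _ ≤ 1 / (n : ℝ) * _ := mul_le_mul_of_nonneg_left hsum (by positivity)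
      _ = _ := by
        rw [Finset.sum_add_distrib, ← Finset.mul_sum, mul_add, totalVariation,
          mul_left_comm, Finset.mul_sum (a := 1 / (n : ℝ))]
        congr 1
        · congr 1
          exact Finset.sum_congr rfl fun J _ => by ring
        · ring

/-! ### Optimal sharing of the cells and choice of their number. -/

theorem exists_allocation {ι : Type*} (P : Finset ι) {A : ι → ℝ} (hA : ∀ J ∈ P, 0 ≤ A J) {m : ℕ}
    (hm : 0 < m) : ∃ M : ι → ℕ, (∀ J, 0 < M J) ∧ ∑ J ∈ P, M J ≤ m + P.card ∧
      ∑ J ∈ P, A J / (M J : ℝ) ^ 2 ≤ (∑ J ∈ P, A J ^ (1 / 3 : ℝ)) ^ 3 / (m : ℝ) ^ 2 := by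
  have hm' : (0 : ℝ) < m := by exact_mod_cast hm
  set S := ∑ J ∈ P, A J ^ (1 / 3 : ℝ) with hS
  have hS0 : 0 ≤ S := Finset.sum_nonneg fun J hJ => Real.rpow_nonneg (hA J hJ) _
  set w : ι → ℝ := fun J => A J ^ (1 / 3 : ℝ) / S with hw
  have hw0 : ∀ J ∈ P, 0 ≤ w J := fun J hJ => div_nonneg (Real.rpow_nonneg (hA J hJ) _) hS0
  have hw1 : ∑ J ∈ P, w J ≤ 1 := by
    rw [← Finset.sum_div, ← hS]
    exact div_self_le_one S
  have hcube : ∀ J ∈ P, A J = (A J ^ (1 / 3 : ℝ)) ^ 3 := fun J hJ => by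
    rw [← Real.rpow_natCast, ← Real.rpow_mul (hA J hJ)]
    norm_num
  -- Weights proportional to `A ^ (1 / 3)` minimise `∑ A / M ^ 2` for a given total. The added `1`
  -- keeps each `M J` positive and costs `P.card`.
  refine ⟨fun J => ⌊m * w J⌋₊ + 1, fun J => Nat.succ_pos _, ?_, ?_⟩
  · have : ∑ J ∈ P, ((⌊m * w J⌋₊ + 1 : ℕ) : ℝ) ≤ m + P.card := by
      push_cast
      rw [Finset.sum_add_distrib]
      refine add_le_add ?_ (by simp)
      calc _ ≤ ∑ J ∈ P, m * w J := Finset.sum_le_sum fun J hJ =>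
            Nat.floor_le (mul_nonneg hm'.le (hw0 J hJ))
        _ ≤ m := by
          rw [← Finset.mul_sum]
          exact mul_le_of_le_one_right hm'.le hw1
    exact_mod_cast this
  · have key : ∀ J ∈ P, A J / ((⌊m * w J⌋₊ + 1 : ℕ) : ℝ) ^ 2 ≤
        A J ^ (1 / 3 : ℝ) * (S ^ 2 / (m : ℝ) ^ 2) := by
      intro J hJ
      have hr0 : 0 ≤ A J ^ (1 / 3 : ℝ) := Real.rpow_nonneg (hA J hJ) _
      have hle : A J ^ (1 / 3 : ℝ) ≤ S :=
        Finset.single_le_sum (fun J hJ => Real.rpow_nonneg (hA J hJ) _) hJ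
      have hfl : (m : ℝ) * w J ≤ ((⌊m * w J⌋₊ + 1 : ℕ) : ℝ) := by
        push_cast
        exact (Nat.lt_floor_add_one _).le
      have hr : A J ^ (1 / 3 : ℝ) = w J * S := by
        -- If `S = 0`, then `w J = 0` by division by zero, and `A J ^ (1 / 3)` vanishes too.
        rcases hS0.eq_or_lt with h | h
        · rw [← h] at hle ⊢
          rw [mul_zero]
          exact le_antisymm hle hr0
        · simp only [hw]
          rw [div_mul_cancel₀ _ h.ne']
      have hpos : (0 : ℝ) < ((⌊m * w J⌋₊ + 1 : ℕ) : ℝ) := by positivity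
      rw [div_le_iff₀ (by positivity)]
      have h2 : (m * w J) ^ 2 ≤ (((⌊m * w J⌋₊ + 1 : ℕ) : ℝ)) ^ 2 :=
        pow_le_pow_left₀ (mul_nonneg hm'.le (hw0 J hJ)) hfl 2
      calc A J = A J ^ (1 / 3 : ℝ) * (S ^ 2 / (m : ℝ) ^ 2) * (m * w J) ^ 2 := by
            nth_rewrite 1 [hcube J hJ]
            rw [hr]
            field_simp
        _ ≤ _ := by gcongr
    calc _ ≤ _ := Finset.sum_le_sum key
      _ = _ := by rw [← Finset.sum_mul, ← hS]; ring

/-- The real number `M` with `M ^ (s + 2) = W n ^ s / τ` solves `W / M ^ 2 = τ (M / n) ^ s`, and the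
common value is the main term. Subadditivity of `t ^ s` separates the contribution of `k`. -/
theorem exists_dimension {W τ s : ℝ} (hW : 0 ≤ W) (hτ : 0 < τ) (hs0 : 0 ≤ s) (hs1 : s ≤ 1) {n k : ℕ}
    (hn : 0 < n) (hk : 1 ≤ k) :
    ∃ m : ℕ, 0 < m ∧
      W / (m : ℝ) ^ 2 ≤ τ ^ (2 / (s + 2)) * (Real.sqrt W / n) ^ (2 * s / (s + 2)) ∧
      τ * (((m : ℝ) + k) / n) ^ s ≤
        τ ^ (2 / (s + 2)) * (Real.sqrt W / n) ^ (2 * s / (s + 2)) +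
          τ * ((7 * (k : ℝ) - 2) / n) ^ s := by
  have hn' : (0 : ℝ) < n := by exact_mod_cast hn
  have hk' : (1 : ℝ) ≤ k := by exact_mod_cast hk
  have hs2 : 0 < s + 2 := by linarith
  set e : ℝ := s / (s + 2) with he
  set T : ℝ := τ ^ (2 / (s + 2)) * (Real.sqrt W / n) ^ (2 * s / (s + 2)) with hT
  have hT0 : 0 ≤ T := by positivity
  set R : ℝ := W * (n : ℝ) ^ s / τ with hR
  have hR0 : 0 ≤ R := by positivity
  set M : ℝ := R ^ (1 / (s + 2)) with hM
  have hM0 : 0 ≤ M := by positivity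
  have hTM : τ * (M / n) ^ s = T := by
    have h1 : (Real.sqrt W / n) ^ (2 * s / (s + 2)) = W ^ e * (n : ℝ) ^ (-(2 * e)) := by
      rw [show 2 * s / (s + 2) = (2 : ℕ) * e by rw [he]; push_cast; ring, Real.rpow_natCast_mul
        (by positivity), div_pow, Real.sq_sqrt hW, Real.div_rpow hW (by positivity),
        Real.rpow_neg hn'.le, ← Real.rpow_natCast_mul hn'.le]
      push_cast
      rfl
    have h2 : M ^ s = W ^ e * (n : ℝ) ^ (s * e) / τ ^ e := by
      rw [hM, ← Real.rpow_mul hR0, show 1 / (s + 2) * s = e by rw [he]; ring, hR,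
        Real.div_rpow (by positivity) hτ.le, Real.mul_rpow hW (by positivity),
        ← Real.rpow_mul hn'.le]
    have h3 : τ ^ (2 / (s + 2)) = τ / τ ^ e := by
      rw [show 2 / (s + 2) = 1 - e by rw [he]; field_simp; ring, Real.rpow_sub hτ, Real.rpow_one]
    have h4 : (n : ℝ) ^ (-(2 * e)) = (n : ℝ) ^ (s * e) / (n : ℝ) ^ s := by
      rw [← Real.rpow_sub hn']
      congr 1
      rw [he]; field_simp; ring
    rw [hT, h1, h3, h4, Real.div_rpow hM0 hn'.le, h2]
    ring
  have hWT : W = T * M ^ 2 := by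
    have h1 : M ^ (s + 2) = R := by
      rw [hM, ← Real.rpow_mul hR0, one_div_mul_cancel hs2.ne', Real.rpow_one]
    rw [Real.rpow_add_of_nonneg hM0 hs0 (by norm_num), Real.rpow_two] at h1
    rw [← hTM, Real.div_rpow hM0 hn'.le]
    have h2 : τ * (M ^ s / (n : ℝ) ^ s) * M ^ 2 = τ / (n : ℝ) ^ s * (M ^ s * M ^ 2) := by ring
    rw [h2, h1, hR]
    have : (0 : ℝ) < (n : ℝ) ^ s := by positivity
    field_simp
  refine ⟨⌊M⌋₊ + 1, Nat.succ_pos _, ?_, ?_⟩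
  · have h1 : M ≤ ((⌊M⌋₊ + 1 : ℕ) : ℝ) := by
      push_cast
      exact (Nat.lt_floor_add_one M).le
    rw [div_le_iff₀ (by positivity)]
    calc W = T * M ^ 2 := hWT
      _ ≤ _ := by gcongr
  -- `1 + k ≤ 7 k - 2` because `k ≥ 1`.
  · have h1 : ((⌊M⌋₊ + 1 : ℕ) : ℝ) + k ≤ M + (7 * (k : ℝ) - 2) := by
      push_cast
      have := Nat.floor_le hM0
      linarith
    have h7 : 0 ≤ 7 * (k : ℝ) - 2 := by linarith
    calc τ * ((((⌊M⌋₊ + 1 : ℕ) : ℝ) + k) / n) ^ s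
        ≤ τ * (M / n + (7 * (k : ℝ) - 2) / n) ^ s := by
          rw [← add_div]
          gcongr
      _ ≤ τ * ((M / n) ^ s + ((7 * (k : ℝ) - 2) / n) ^ s) := by
          gcongr
          exact Real.rpow_add_le_add_rpow (by positivity) (by positivity) hs0 hs1
      _ = _ := by rw [mul_add, hTM]

theorem riskBound_le {α : Type*} {n : ℕ} {κ : ℝ} (hκ : 0 ≤ κ) {σ : ℝ → ℝ≥0∞} {x : Fin n → α}
    {f g : α → ℝ} {F : Set (α → ℝ)} {D : ℕ} (hD : 1 ≤ D) (hg : g ∈ extremalSet x F D) {p : ℝ}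
    (hp : p ∈ Icc (1 : ℝ) 2) (hσ : σ p ≠ ⊤) :
    riskBound κ σ x f F ≤ ENNReal.ofReal
      (3 * loss x f g + κ * ((σ p).toReal * ((D : ℝ) / n) ^ (1 - 1 / p))) := by
  have hl : 0 ≤ loss x f g := by
    unfold loss
    positivity
  rw [ENNReal.ofReal_add (by positivity) (by positivity), ENNReal.ofReal_mul (by norm_num),
    ENNReal.ofReal_mul hκ, ENNReal.ofReal_mul ENNReal.toReal_nonneg, ENNReal.ofReal_toReal hσ]
  refine (iInf₂_le D hD).trans (add_le_add ?_ ?_)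
  · rw [show ENNReal.ofReal 3 = 3 by simp]
    gcongr
    exact iInf₂_le g hg
  · gcongr
    exact iInf₂_le p hp

end ShapeRegression

/-! ### Assembly of the risk bound. -/

theorem mainTheorem7 (κ : ℝ) (hκ : 0 < κ) :
    ∃ C : ℝ, 0 < C ∧
      ∀ (a b : ℝ), a < b →
      ∀ (k : ℕ), 1 ≤ k →
      ∀ (n : ℕ), 1 ≤ n →
      ∀ (x : Fin n → ℝ), ShapeRegression.IsEquispaced a b x →
      ∀ (fstar : ℝ → ℝ), fstar ∈ ShapeRegression.mccClass a b k →
      ∀ (P : Finset (Set ℝ)), ShapeRegression.IsMCCPartition a b k fstar P →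
      ∀ (Ω : Type*) [MeasurableSpace Ω] (μ : Measure Ω) [IsProbabilityMeasure μ]
        (Y : Fin n → Ω → ℝ),
        (∀ i, Integrable (Y i) μ) → iIndepFun Y μ → (∀ i, ∫ ω, Y i ω ∂μ = fstar (x i)) →
      ∀ (σ : ℝ → ℝ≥0∞),
        (∀ q ∈ Icc (1 : ℝ) 2, 0 < σ q ∧ ShapeRegression.averageMoment μ Y q ≤ σ q) →
      ∀ (p : ℝ), p ∈ Icc (1 : ℝ) 2 → σ p < ⊤ →
      ∀ (s : ℝ), s = 1 - 1 / p →
        ShapeRegression.riskBound κ σ x fstar (ShapeRegression.mccClass a b k) ≤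
          ENNReal.ofReal (C *
            ((σ p).toReal ^ (2 / (s + 2)) *
                (Real.sqrt (ShapeRegression.variationIndex x fstar P) / (n : ℝ)) ^
                  (2 * s / (s + 2)) +
              (σ p).toReal * ((7 * (k : ℝ) - 2) / (n : ℝ)) ^ s +
              ShapeRegression.totalVariation fstar P / (n : ℝ))) := by
  open ShapeRegression in
  -- `51 = 3 · 16 + 3` covers the approximation error; `12 κ` comes from `D ≤ 12 (m + k)`.
  refine ⟨51 + 12 * κ, by positivity, ?_⟩
  intro a b hab k hk n hn x hx f hfm P hP Ω _ μ _ Y _ _ _ σ hσ p hp hσp s hs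
  have hn' : (0 : ℝ) < n := by exact_mod_cast hn
  have hk' : (1 : ℝ) ≤ k := by exact_mod_cast hk
  have hp1 : 1 ≤ p := hp.1
  have hs0 : 0 ≤ s := by
    rw [hs, sub_nonneg]
    exact div_le_one_of_le₀ hp1 (by linarith)
  have hs1 : s ≤ 1 := by
    rw [hs, sub_le_self_iff]
    positivity
  have hτ : 0 < (σ p).toReal := ENNReal.toReal_pos (hσ p hp).1.ne' hσp.ne
  have hfc : ContinuousOn f (Icc a b) := hfm.1
  have hA : ∀ J ∈ P, 0 ≤ ((designCount x J : ℝ) * variationOn f J *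
      linearIndex f (sInf J) (sSup J)) / n := fun J hJ => by
    obtain ⟨h1, -, -, h2⟩ := hP.geometry hJ
    obtain ⟨h3, h4⟩ := hP.2.2.2.2 J hJ
    rw [h2] at h3 h4
    obtain ⟨α, hα⟩ := exists_slopeBound h1 h3 h4
    have hV : 0 ≤ variationOn f J := (abs_nonneg _).trans
      (abs_sub_le_variationOn (hP.2.1 J hJ).1 (hP.2.1 J hJ).2 (hP.subset hJ) hfc)
    have hΓ := hα.2.2.1
    positivity
  have hV : 0 ≤ totalVariation f P := Finset.sum_nonneg fun J hJ => (abs_nonneg _).trans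
    (abs_sub_le_variationOn (hP.2.1 J hJ).1 (hP.2.1 J hJ).2 (hP.subset hJ) hfc)
  have hW : 0 ≤ variationIndex x f P :=
    pow_nonneg (Finset.sum_nonneg fun J hJ => Real.rpow_nonneg (hA J hJ) _) 3
  obtain ⟨m, hm, hm1, hm2⟩ := exists_dimension hW hτ hs0 hs1 hn hk
  obtain ⟨M, hM, hM1, hM2⟩ := exists_allocation P hA hm
  obtain ⟨F, hF, hloss⟩ := exists_extremal_approx hab hn hx hfc hP hM
  refine (riskBound_le hκ.le (by omega) hF hp hσp.ne).trans (ENNReal.ofReal_le_ofReal ?_)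
  rw [← hs]
  have hD : ((4 * (k + ∑ J ∈ P, M J + 1) : ℕ) : ℝ) ≤ 12 * ((m : ℝ) + k) := by
    have h1 : P.card ≤ k := hP.1
    have : 4 * (k + ∑ J ∈ P, M J + 1) ≤ 12 * (m + k) := by omega
    exact_mod_cast this
  have h12 : (((4 * (k + ∑ J ∈ P, M J + 1) : ℕ) : ℝ) / n) ^ s ≤ 12 * (((m : ℝ) + k) / n) ^ s := by
    calc _ ≤ (12 * (((m : ℝ) + k) / n)) ^ s := by
          rw [← mul_div_assoc]
          gcongr
      _ = (12 : ℝ) ^ s * (((m : ℝ) + k) / n) ^ s := Real.mul_rpow (by norm_num) (by positivity)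
      _ ≤ _ := by
          gcongr
          calc (12 : ℝ) ^ s ≤ 12 ^ (1 : ℝ) := Real.rpow_le_rpow_of_exponent_le (by norm_num) hs1
            _ = 12 := Real.rpow_one 12
  set T := (σ p).toReal ^ (2 / (s + 2)) *
    (Real.sqrt (variationIndex x f P) / n) ^ (2 * s / (s + 2)) with hT
  have hT0 : 0 ≤ T := by positivity
  set U := (σ p).toReal * ((7 * (k : ℝ) - 2) / n) ^ s with hU
  have hU0 : 0 ≤ U := by
    have : 0 ≤ 7 * (k : ℝ) - 2 := by linarith
    positivity
  have hl : loss x f F ≤ 16 * T + totalVariation f P / n :=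
    hloss.trans (add_le_add (mul_le_mul_of_nonneg_left (hM2.trans hm1) (by norm_num)) le_rfl)
  have hVn : 0 ≤ totalVariation f P / n := by positivity
  have h3 : (σ p).toReal * (((4 * (k + ∑ J ∈ P, M J + 1) : ℕ) : ℝ) / n) ^ s ≤ 12 * (T + U) := by
    calc _ ≤ (σ p).toReal * (12 * (((m : ℝ) + k) / n) ^ s) := by gcongr
      _ = 12 * ((σ p).toReal * (((m : ℝ) + k) / n) ^ s) := by ring
      _ ≤ _ := by gcongr
  have h4 := mul_le_mul_of_nonneg_left h3 hκ.le
  have h5 := mul_nonneg hκ.le hVn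
  linarith
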